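/- Fix $N\ge 2$, $\beta\in[0,1)$ and finitely many classes $k=1,\dots,Q$. A bandit of class $k$ is given by an irreducible, aperiodic transition matrix $T^{(k)}$ on $N$ states ($T^{(k)}_{ab}$ is the probability of moving from $a$ to $b$) and a success probability $\rho_k\in(0,1]$. Its state is a belief $x$ in the probability simplex $\Omega\subset\mathbb R^N$. Under the passive action $x$ moves to $xT^{(k)}$; under the active action it moves to the $s$-th row $T^{(k)}_s$ of $T^{(k)}$ with probability $\rho_k x_s$, $s=1,\dots,N$, and to $xT^{(k)}$ with probability $1-\rho_k$. Its cost per slot is the uncertainty of information $H(x)=-\sum_s x_s\log_2x_s$. Let $q_k>0$ with $\sum_kq_k=1$, and let $\alpha\in(0,1)$. For every $M$ for which the numbers $Mq_k$ and $m=\alpha M$ are integers, consider $M$ bandits, $Mq_k$ of them of class $k$; given the actions, the bandits move independently. Policies may be randomised and history dependent. The cost of a policy is $E\big[\sum_{t\ge1}\beta^{t-1}\sum_{i=1}^M H(X_i(t))\big]$. In the original problem exactly $m$ bandits are activated in every slot; in the relaxed problem it is only required that $E\big[\sum_{t\ge1}\beta^{t-1}\sum_{i=1}^M u_i(t)\big]=m/(1-\beta)$,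 where $u_i(t)\in\{0,1\}$ is the action for bandit $i$. For $\lambda\ge0$ let $V_k(x,\lambda)$ be the minimal expected value of $\sum_{t\ge1}\beta^{t-1}\,[H(X(t))+\lambda u(t)]$ for a single bandit of class $k$ started at $x$. Assumption 1: for each class $k$ there are a stationary (possibly randomised) policy $\pi^*_k$ and an equilibrium distribution $\mu_k$ of a bandit of class $k$ under $\pi^*_k$, neither depending on $M$, such that the initial state has independent components, those of class $k$ being distributed as $\mu_k$, and such that the policy $\pi^*$ under which all bandits independently follow the policies $\pi^*_k$ of their classes is optimal for the relaxed problem with this random initial state. Let $\lambda^*$ be any maximiser over $\lambda\ge0$ of $M\sum_k q_k\int V_k(x,\lambda)\,d\mu_k(x)-\frac{m\lambda}{1-\beta}$. The gain index of a bandit of class $k$ in state $x$ is $$W_k(x)=\rho_k\Big[V_k\big(xT^{(k)},\lambda^*\big)-\sum_s x_sV_k\big(T^{(k)}_s,\lambda^*\big)\Big].$$ The gain index policy activates in every slot $m$ bandits with the $m$ largest indices; among bandits with equal index, those for which $\pi^*$ (independently sampled at the current state if it is randomised) takes the active action come first, and the remaining ties are broken arbitrarily. (When $\pi^*_k$ is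 the policy that is active exactly when $\beta W_k(x)\ge\lambda^*$, the first tie-breaking rule is void, so that all ties are broken arbitrarily.) Let $J_M^{ind}$, $J_M^{opt}$ and $J_M^{rel}$ be, for this random initial state, the cost of the gain index policy, the optimal value of the original problem and the optimal value of the relaxed problem. Then, as $M\to\infty$ through the values above, the three limits exist and $$\lim_{M\to\infty}\frac1MJ_M^{ind}=\lim_{M\to\infty}\frac1MJ_M^{opt}=\lim_{M\to\infty}\frac1MJ_M^{rel}.$$ -/

import Mathlib

open Filter Topology
open scoped ENNReal

noncomputable section

namespace UoI

/-! ### Expectations, products and discounted Markov decision processes -/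

/-- Expectation of a real function under a discrete probability law. -/
def expect {α : Type*} (p : PMF α) (f : α → ℝ) : ℝ := ∑' a, (p a).toReal * f a

theorem tsum_pi_prod {α : Type*} (ι : Type) [Fintype ι] :
    ∀ f : ι → α → ℝ≥0∞, ∑' x : ι → α, ∏ i, f i (x i) = ∏ i, ∑' a, f i a := by
  refine Fintype.induction_empty_option
    (P := fun ι _ => ∀ f : ι → α → ℝ≥0∞, ∑' x : ι → α, ∏ i, f i (x i) = ∏ i, ∑' a, f i a)
    ?_ ?_ ?_ ι
  · intro β γ hγ e ih f
    let : Fintype β := Fintype.ofEquiv γ e.symm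
    rw [← (Equiv.arrowCongr e (Equiv.refl α)).tsum_eq, ← Equiv.prod_comp e]
    rw [← ih (fun b => f (e b))]
    refine tsum_congr fun x => ?_
    rw [← Equiv.prod_comp e]
    simp
  · intro f
    simp
  · intro β hβ ih f
    rw [← (Equiv.piOptionEquivProd (β := fun _ : Option β => α)).symm.tsum_eq, ENNReal.tsum_prod',
      Fintype.prod_option, ← ih (fun b => f (some b)), ← ENNReal.tsum_mul_right]
    refine tsum_congr fun a => ?_
    rw [← ENNReal.tsum_mul_left]
    refine tsum_congr fun x => ?_
    rw [Fintype.prod_option]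
    rfl

/-- The joint law of finitely many independent random variables with laws `p i`. -/
def indep {ι : Type} [Fintype ι] {α : Type*} (p : ι → PMF α) : PMF (ι → α) :=
  ⟨fun x => ∏ i, p i (x i), by
    have h : ∑' x : ι → α, ∏ i, p i (x i) = 1 := by
      rw [tsum_pi_prod ι (fun i a => p i a)]
      simp [PMF.tsum_coe]
    exact h ▸ ENNReal.summable.hasSum⟩

/-- A randomised, history dependent policy: given the past state-action pairs (most recent first)
and the current state, it returns the law of the next action. -/
abbrev Policy (S A : Type*) := List (S × A) → S → PMF A

/-- The joint law of the past and of the current state after `n` transitions of the controlled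
process with transition law `step`, policy `π` and initial law `p₀`. -/
def historyLaw {S A : Type*} (step : S → A → PMF S) (π : Policy S A) (p₀ : PMF S) :
    ℕ → PMF (List (S × A) × S)
  | 0 => p₀.map fun x => ([], x)
  | n + 1 => (historyLaw step π p₀ n).bind fun h =>
      (π h.1 h.2).bind fun a => (step h.2 a).map fun y => ((h.2, a) :: h.1, y)

/-- The joint law of the state and the action at the `n`-th decision (`n = 0, 1, …`). -/
def stateActionLaw {S A : Type*} (step : S → A → PMF S) (π : Policy S A) (p₀ : PMF S) (n : ℕ) :
    PMF (S × A) :=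
  (historyLaw step π p₀ n).bind fun h => (π h.1 h.2).map fun a => (h.2, a)

/-- Expected total discounted cost `∑ₙ βⁿ E[c(xₙ, aₙ)]`. -/
def discounted {S A : Type*} (β : ℝ) (step : S → A → PMF S) (c : S → A → ℝ) (π : Policy S A)
    (p₀ : PMF S) : ℝ :=
  ∑' n : ℕ, β ^ n * expect (stateActionLaw step π p₀ n) fun z => c z.1 z.2

/-! ### A single bandit -/

/-- The probability simplex of distributions on the `N` states of a chain. -/
abbrev Belief (N : ℕ) := stdSimplex ℝ (Fin N)

/-- Data of one remote chain: an irreducible, aperiodic transition matrix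
(`T n k = P[S(t+1) = k | S(t) = n]`) and a transmission success probability. -/
structure Source (N : ℕ) where
  T : Matrix (Fin N) (Fin N) ℝ
  stochastic : T ∈ Matrix.rowStochastic ℝ (Fin N)
  irreducible : T.IsIrreducible
  aperiodic : ∀ i, ∀ d : ℕ, (∀ n : ℕ, 0 < n → 0 < (T ^ n) i i → d ∣ n) → d = 1
  ρ : ℝ
  ρ_pos : 0 < ρ
  ρ_le_one : ρ ≤ 1

/-- Shannon entropy in bits. -/
def entropy {N : ℕ} (x : Belief N) : ℝ := -∑ k, x k * Real.logb 2 (x k)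

variable {N : ℕ}

/-- The belief after one step without an observation. -/
def Source.push (C : Source N) (x : Belief N) : Belief N :=
  ⟨Matrix.vecMul x C.T, fun k => Matrix.nonneg_vecMul_of_mem_rowStochastic C.stochastic x.2.1 k, by
    have h := Matrix.vecMul_dotProduct_one_eq_one_rowStochastic (x := (x : Fin N → ℝ)) C.stochastic
      ((dotProduct_one _).trans x.2.2)
    simpa [dotProduct] using h⟩

/-- The belief after the state `k` has been observed: the law of the next state given that the
current one is `k`. -/
def Source.obs (C : Source N) (k : Fin N) : Belief N :=
  ⟨fun j => C.T k j, fun _ => Matrix.nonneg_of_mem_rowStochastic C.stochastic,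
    Matrix.sum_row_of_mem_rowStochastic C.stochastic k⟩

/-- The law of what the monitor receives from an activated bandit in belief state `x`:
`some k` (state `k`) with probability `ρ * x k`, and `none` with probability `1 - ρ`. -/
def Source.reception (C : Source N) (x : Belief N) : PMF (Option (Fin N)) :=
  PMF.ofFintype (fun o => ENNReal.ofReal (o.elim (1 - C.ρ) fun k => C.ρ * x k)) (by
    have h0 : ∀ k : Fin N, 0 ≤ x k := x.2.1
    have hs : ∑ k, x k = 1 := x.2.2
    rw [← ENNReal.ofReal_sum_of_nonneg, Fintype.sum_option]
    · simp [← Finset.mul_sum, hs]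
    · rintro (_ | k) _
      · simpa using C.ρ_le_one
      · exact mul_nonneg C.ρ_pos.le (h0 k))

/-- Belief transition law; the action `true` is active and `false` is passive. -/
def Source.step (C : Source N) (x : Belief N) : Bool → PMF (Belief N)
  | false => PMF.pure (C.push x)
  | true => (C.reception x).map fun o => o.elim (C.push x) C.obs

/-- Optimal value of the single bandit problem with service charge `lam` started at `x`. -/
def Source.value (C : Source N) (β lam : ℝ) (x : Belief N) : ℝ :=
  ⨅ π : Policy (Belief N) Bool,
    discounted β C.step (fun y u => entropy y + if u then lam else 0) π (PMF.pure x)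

/-- The gain index of a belief state for the service charge `lam`. -/
def Source.gainIndex (C : Source N) (β lam : ℝ) (x : Belief N) : ℝ :=
  C.ρ * (C.value β lam (C.push x) - ∑ k, x k * C.value β lam (C.obs k))

/-- `μ` is an equilibrium law of the bandit under the stationary randomised policy `π`. -/
def Source.IsEquilibrium (C : Source N) (π : Belief N → PMF Bool) (μ : PMF (Belief N)) : Prop :=
  (μ.bind fun x => (π x).bind fun u => C.step x u) = μ

/-! ### The restless multi-armed bandit -/

/-- `M` bandits, the `i`-th one being a copy of `source (cls i)`, of which `m` are activated in each
slot. -/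
structure RMAB {Q N : ℕ} (source : Fin Q → Source N) where
  M : ℕ
  cls : Fin M → Fin Q
  m : ℕ

variable {Q : ℕ} {source : Fin Q → Source N}

/-- The chain of the `i`-th bandit. -/
abbrev RMAB.src (R : RMAB source) (i : Fin R.M) : Source N := source (R.cls i)

/-- Joint belief states. -/
abbrev RMAB.State (R : RMAB source) := Fin R.M → Belief N

/-- Joint actions. -/
abbrev RMAB.Action (R : RMAB source) := Fin R.M → Bool

/-- Given the actions, the bandits move independently. -/
def RMAB.step (R : RMAB source) (x : R.State) (u : R.Action) : PMF R.State :=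
  indep fun i => (R.src i).step (x i) (u i)

/-- Number of activated bandits. -/
def RMAB.active (R : RMAB source) (u : R.Action) : ℕ := (Finset.univ.filter fun i => u i = true).card

/-- Independent bandits, those of class `k` having law `μ k`. -/
def RMAB.initial (R : RMAB source) (μ : Fin Q → PMF (Belief N)) : PMF R.State :=
  indep fun i => μ (R.cls i)

/-- Expected total discounted UoI. -/
def RMAB.cost (R : RMAB source) (β : ℝ) (p₀ : PMF R.State) (π : Policy R.State R.Action) : ℝ :=
  discounted β R.step (fun x _ => ∑ i, entropy (x i)) π p₀

/-- Expected total discounted number of activations. -/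
def RMAB.usage (R : RMAB source) (β : ℝ) (p₀ : PMF R.State) (π : Policy R.State R.Action) : ℝ :=
  discounted β R.step (fun _ u => (R.active u : ℝ)) π p₀

/-- Exactly `m` bandits are activated in each slot. -/
def RMAB.Admissible (R : RMAB source) (π : Policy R.State R.Action) : Prop :=
  ∀ h x, ∀ u ∈ (π h x).support, R.active u = R.m

/-- The relaxed constraint: the expected discounted number of activations is `m / (1 - β)`. -/
def RMAB.RelaxedAdmissible (R : RMAB source) (β : ℝ) (p₀ : PMF R.State)
    (π : Policy R.State R.Action) : Prop :=
  R.usage β p₀ π = R.m / (1 - β)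

/-- Optimal value of the RMAB. -/
def RMAB.optValue (R : RMAB source) (β : ℝ) (p₀ : PMF R.State) : ℝ :=
  ⨅ π : {π : Policy R.State R.Action // R.Admissible π}, R.cost β p₀ π.1

/-- Optimal value of the relaxed problem. -/
def RMAB.relValue (R : RMAB source) (β : ℝ) (p₀ : PMF R.State) : ℝ :=
  ⨅ π : {π : Policy R.State R.Action // R.RelaxedAdmissible β p₀ π}, R.cost β p₀ π.1

/-- The objective of the dual of the relaxed problem for the initial law `R.initial μ`. -/
def RMAB.dual (R : RMAB source) (β : ℝ) (μ : Fin Q → PMF (Belief N)) (lam : ℝ) : ℝ :=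
  ∑ i, expect (μ (R.cls i)) ((R.src i).value β lam) - R.m * lam / (1 - β)

/-- `lam` is an optimal service charge, i.e. it maximises the dual objective over `[0, ∞)`. -/
def RMAB.IsOptimalCharge (R : RMAB source) (β : ℝ) (μ : Fin Q → PMF (Belief N)) (lam : ℝ) : Prop :=
  0 ≤ lam ∧ ∀ l, 0 ≤ l → R.dual β μ l ≤ R.dual β μ lam

/-- The decoupled policy under which each bandit of class `k` follows, independently of the others,
the stationary randomised policy `π k`. -/
def RMAB.decoupled (R : RMAB source) (π : Fin Q → Belief N → PMF Bool) :
    Policy R.State R.Action :=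
  fun _ x => indep fun i => π (R.cls i) (x i)

/-- The decoupled policy given by `π` solves the relaxed problem. -/
def RMAB.IsOptimalRelaxed (R : RMAB source) (β : ℝ) (μ : Fin Q → PMF (Belief N))
    (π : Fin Q → Belief N → PMF Bool) : Prop :=
  R.RelaxedAdmissible β (R.initial μ) (R.decoupled π) ∧
    ∀ π' : Policy R.State R.Action, R.RelaxedAdmissible β (R.initial μ) π' →
      R.cost β (R.initial μ) (R.decoupled π) ≤ R.cost β (R.initial μ) π'

/-- The gain index of the `i`-th bandit in the joint state `x`. -/
def RMAB.index (R : RMAB source) (β lam : ℝ) (x : R.State) (i : Fin R.M) : ℝ :=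
  (R.src i).gainIndex β lam (x i)

/-- `sel x v` is a choice of `m` bandits with the `m` largest gain indices in state `x`; bandits of
equal index are ranked by the action `v i` that the relaxed policy draws for them (active ones
first), and are otherwise chosen arbitrarily. -/
def RMAB.IsGainSelection (R : RMAB source) (β lam : ℝ)
    (sel : R.State → R.Action → Finset (Fin R.M)) : Prop :=
  ∀ x v, (sel x v).card = R.m ∧ ∀ i ∈ sel x v, ∀ j ∉ sel x v,
    R.index β lam x j < R.index β lam x i ∨
      (R.index β lam x j = R.index β lam x i ∧ (v j = true → v i = true))

/-- The policy that, in state `x`, draws the action `v` of the decoupled policy and activates the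
bandits in `sel x v`. -/
def RMAB.selectionPolicy (R : RMAB source) (π : Fin Q → Belief N → PMF Bool)
    (sel : R.State → R.Action → Finset (Fin R.M)) : Policy R.State R.Action :=
  fun h x => (R.decoupled π h x).map fun v i => decide (i ∈ sel x v)

end UoI

end

noncomputable section

namespace UoI

/-! ### Expectations of bounded functions -/

/-- A bounded real function. -/
def IsBdd {α : Type*} (f : α → ℝ) : Prop := ∃ C, ∀ a, |f a| ≤ C

namespace IsBdd

variable {α γ : Type*} {f g : α → ℝ}

theorem const (c : ℝ) : IsBdd fun _ : α => c := ⟨|c|, fun _ => le_rfl⟩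

theorem comp (hf : IsBdd f) (g : γ → α) : IsBdd fun a => f (g a) := by
  obtain ⟨C, hC⟩ := hf
  exact ⟨C, fun a => hC _⟩

theorem add (hf : IsBdd f) (hg : IsBdd g) : IsBdd fun a => f a + g a := by
  obtain ⟨C, hC⟩ := hf
  obtain ⟨D, hD⟩ := hg
  exact ⟨C + D, fun a => (abs_add_le _ _).trans (add_le_add (hC a) (hD a))⟩

theorem mul (hf : IsBdd f) (hg : IsBdd g) : IsBdd fun a => f a * g a := by
  obtain ⟨C, hC⟩ := hf
  obtain ⟨D, hD⟩ := hg
  refine ⟨C * D, fun a => ?_⟩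
  rw [abs_mul]
  exact mul_le_mul (hC a) (hD a) (abs_nonneg _) ((abs_nonneg _).trans (hC a))

theorem const_mul (hf : IsBdd f) (c : ℝ) : IsBdd fun a => c * f a := (const c).mul hf

theorem neg (hf : IsBdd f) : IsBdd fun a => -f a := by
  simpa using hf.const_mul (-1)

theorem sub (hf : IsBdd f) (hg : IsBdd g) : IsBdd fun a => f a - g a := by
  simpa [sub_eq_add_neg] using hf.add hg.neg

theorem abs (hf : IsBdd f) : IsBdd fun a => |f a| := by
  obtain ⟨C, hC⟩ := hf
  exact ⟨C, fun a => by simpa using hC a⟩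

theorem sum {ι : Type*} (s : Finset ι) {f : ι → α → ℝ} (hf : ∀ i ∈ s, IsBdd (f i)) :
    IsBdd fun a => ∑ i ∈ s, f i a := by
  classical
  induction s using Finset.induction_on with
  | empty => simpa using const (α := α) 0
  | insert i s hi ih =>
    simp only [Finset.sum_insert hi]
    exact (hf i (by simp)).add (ih fun j hj => hf j (by simp [hj]))

theorem of_fintype [Finite α] (f : α → ℝ) : IsBdd f := by
  cases nonempty_fintype α
  exact ⟨∑ a, |f a|, fun a =>
    Finset.single_le_sum (f := fun a => |f a|) (fun _ _ => abs_nonneg _) (Finset.mem_univ a)⟩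

end IsBdd

section Expect

variable {α γ : Type*} {p : PMF α} {f g : α → ℝ}

theorem summable_toReal_pmf (p : PMF α) : Summable fun a => (p a).toReal :=
  ENNReal.summable_toReal p.tsum_coe_ne_top

theorem tsum_toReal_pmf (p : PMF α) : ∑' a, (p a).toReal = 1 := by
  rw [← ENNReal.tsum_toReal_eq fun a => p.apply_ne_top a, p.tsum_coe, ENNReal.toReal_one]

theorem IsBdd.summable (hf : IsBdd f) (p : PMF α) : Summable fun a => (p a).toReal * f a := by
  obtain ⟨C, hC⟩ := hf
  refine Summable.of_norm_bounded ((summable_toReal_pmf p).mul_right C) fun a => ?_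
  rw [Real.norm_eq_abs, abs_mul, abs_of_nonneg ENNReal.toReal_nonneg]
  exact mul_le_mul_of_nonneg_left (hC a) ENNReal.toReal_nonneg

theorem expect_const (p : PMF α) (c : ℝ) : expect p (fun _ => c) = c := by
  rw [expect, tsum_mul_right, tsum_toReal_pmf, one_mul]

theorem expect_add (hf : IsBdd f) (hg : IsBdd g) :
    expect p (fun a => f a + g a) = expect p f + expect p g := by
  simp only [expect, mul_add]
  exact (hf.summable p).tsum_add (hg.summable p)

theorem expect_sub (hf : IsBdd f) (hg : IsBdd g) :
    expect p (fun a => f a - g a) = expect p f - expect p g := by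
  simp only [expect, mul_sub]
  exact (hf.summable p).tsum_sub (hg.summable p)

theorem expect_const_mul (p : PMF α) (c : ℝ) (f : α → ℝ) :
    expect p (fun a => c * f a) = c * expect p f := by
  simp only [expect, ← tsum_mul_left]
  exact tsum_congr fun a => by ring

theorem expect_sum {ι : Type*} (s : Finset ι) {f : ι → α → ℝ} (hf : ∀ i ∈ s, IsBdd (f i)) :
    expect p (fun a => ∑ i ∈ s, f i a) = ∑ i ∈ s, expect p (f i) := by
  simp only [expect, Finset.mul_sum]
  exact Summable.tsum_finsetSum fun i hi => (hf i hi).summable p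

theorem expect_congr (h : ∀ a ∈ p.support, f a = g a) : expect p f = expect p g := by
  refine tsum_congr fun a => ?_
  by_cases ha : a ∈ p.support
  · rw [h a ha]
  · simp [(PMF.apply_eq_zero_iff p a).2 ha]

theorem expect_mono (hf : IsBdd f) (hg : IsBdd g) (h : ∀ a ∈ p.support, f a ≤ g a) :
    expect p f ≤ expect p g := by
  refine (hf.summable p).tsum_le_tsum (fun a => ?_) (hg.summable p)
  by_cases ha : a ∈ p.support
  · exact mul_le_mul_of_nonneg_left (h a ha) ENNReal.toReal_nonneg
  · simp [(PMF.apply_eq_zero_iff p a).2 ha]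

theorem expect_nonneg (h : ∀ a ∈ p.support, 0 ≤ f a) : 0 ≤ expect p f := by
  refine tsum_nonneg fun a => ?_
  by_cases ha : a ∈ p.support
  · exact mul_nonneg ENNReal.toReal_nonneg (h a ha)
  · simp [(PMF.apply_eq_zero_iff p a).2 ha]

theorem expect_le_const (hf : IsBdd f) {C : ℝ} (h : ∀ a ∈ p.support, f a ≤ C) :
    expect p f ≤ C :=
  (expect_mono hf (.const C) h).trans_eq (expect_const p C)

theorem abs_expect_le (hf : IsBdd f) : |expect p f| ≤ expect p fun a => |f a| := by
  rw [abs_le, ← neg_one_mul, ← expect_const_mul]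
  refine ⟨expect_mono (hf.abs.const_mul _) hf fun a _ => ?_,
    expect_mono hf hf.abs fun a _ => le_abs_self _⟩
  rw [neg_one_mul]
  exact neg_abs_le _

theorem abs_expect_le_const {C : ℝ} (h : ∀ a, |f a| ≤ C) : |expect p f| ≤ C :=
  (abs_expect_le ⟨C, h⟩).trans (expect_le_const (IsBdd.abs ⟨C, h⟩) fun a _ => h a)

theorem eq_zero_of_expect_eq_zero (hf : IsBdd f) (h : ∀ a ∈ p.support, 0 ≤ f a)
    (h0 : expect p f = 0) : ∀ a ∈ p.support, f a = 0 := by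
  intro a ha
  have hnn : ∀ b, 0 ≤ (p b).toReal * f b := by
    intro b
    by_cases hb : b ∈ p.support
    · exact mul_nonneg ENNReal.toReal_nonneg (h b hb)
    · simp [(PMF.apply_eq_zero_iff p b).2 hb]
  have hs := (hf.summable p).hasSum
  rw [← expect, h0] at hs
  have h1 := (hasSum_zero_iff_of_nonneg hnn).1 hs
  have h2 := congrFun h1 a
  have h3 : (p a).toReal ≠ 0 :=
    ENNReal.toReal_ne_zero.2 ⟨(PMF.mem_support_iff p a).1 ha, p.apply_ne_top a⟩
  simpa [h3] using h2

theorem expect_pure (a : α) (f : α → ℝ) : expect (PMF.pure a) f = f a := by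
  classical
  rw [expect, tsum_eq_single a]
  · simp
  · intro b hb
    simp [PMF.pure_apply, hb]

theorem expect_bind {k : α → PMF γ} {f : γ → ℝ} (hf : IsBdd f) :
    expect (p.bind k) f = expect p fun a => expect (k a) f := by
  obtain ⟨C, hC⟩ := hf
  have hs : Summable fun z : α × γ => ((p z.1).toReal * (k z.1 z.2).toReal) * f z.2 := by
    have h1 : Summable fun z : α × γ => (p z.1 * k z.1 z.2).toReal := by
      refine ENNReal.summable_toReal ?_
      rw [ENNReal.tsum_prod']
      simp [ENNReal.tsum_mul_left, PMF.tsum_coe]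
    refine Summable.of_norm_bounded (h1.mul_right C) fun z => ?_
    rw [Real.norm_eq_abs, abs_mul, ENNReal.toReal_mul,
      abs_of_nonneg (mul_nonneg ENNReal.toReal_nonneg ENNReal.toReal_nonneg)]
    exact mul_le_mul_of_nonneg_left (hC _) (mul_nonneg ENNReal.toReal_nonneg ENNReal.toReal_nonneg)
  have h2 : expect (p.bind k) f =
      ∑' b, ∑' a, ((p a).toReal * (k a b).toReal) * f b := by
    refine tsum_congr fun b => ?_
    rw [PMF.bind_apply, ENNReal.tsum_toReal_eq, tsum_mul_right]
    · simp [ENNReal.toReal_mul]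
    · exact fun a => ENNReal.mul_ne_top (p.apply_ne_top a) ((k a).apply_ne_top b)
  rw [h2, Summable.tsum_comm (f := fun a b => ((p a).toReal * (k a b).toReal) * f b) hs]
  refine tsum_congr fun a => ?_
  simp only [expect, ← tsum_mul_left, mul_assoc]

theorem expect_map (h : α → γ) {f : γ → ℝ} (hf : IsBdd f) :
    expect (p.map h) f = expect p fun a => f (h a) := by
  rw [PMF.map, expect_bind hf]
  simp [expect_pure]

end Expect

/-! ### Discounted Markov decision processes -/

section MDP

variable {S A : Type*} {β : ℝ} {step : S → A → PMF S} {π : Policy S A} {p₀ : PMF S}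

theorem exists_of_mem_support_stateActionLaw {n : ℕ} {z : S × A}
    (hz : z ∈ (stateActionLaw step π p₀ n).support) : ∃ h, z.2 ∈ (π h z.1).support := by
  simp only [stateActionLaw, PMF.mem_support_bind_iff, PMF.mem_support_map_iff] at hz
  obtain ⟨h, -, a, ha, rfl⟩ := hz
  exact ⟨h.1, ha⟩

theorem expect_stateActionLaw_fst {V : S → ℝ} (hV : IsBdd V) (n : ℕ) :
    expect (stateActionLaw step π p₀ n) (fun z => V z.1) =
      expect (historyLaw step π p₀ n) fun h => V h.2 := by
  rw [stateActionLaw, expect_bind (hV.comp _)]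
  simp only [expect_map _ (hV.comp _), expect_const]

theorem isBdd_expect {α γ : Type*} {V : γ → ℝ} (hV : IsBdd V) (k : α → PMF γ) :
    IsBdd fun a => expect (k a) V := by
  obtain ⟨C, hC⟩ := hV
  exact ⟨C, fun a => abs_expect_le_const hC⟩

theorem expect_historyLaw_succ {V : S → ℝ} (hV : IsBdd V) (n : ℕ) :
    expect (historyLaw step π p₀ (n + 1)) (fun h => V h.2) =
      expect (stateActionLaw step π p₀ n) fun z => expect (step z.1 z.2) V := by
  have h1 := isBdd_expect hV (fun z : S × A => step z.1 z.2)
  rw [historyLaw, expect_bind (hV.comp _), stateActionLaw, expect_bind h1]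
  simp only [expect_bind (hV.comp _), expect_map _ (hV.comp _), expect_map _ h1]

theorem expect_historyLaw_zero {V : S → ℝ} (hV : IsBdd V) :
    expect (historyLaw step π p₀ 0) (fun h => V h.2) = expect p₀ V := by
  rw [historyLaw, expect_map _ (hV.comp _)]

theorem summable_discount (hβ0 : 0 ≤ β) (hβ1 : β < 1) {e : ℕ → ℝ} {C : ℝ} (he : ∀ n, |e n| ≤ C) :
    Summable fun n => β ^ n * e n := by
  refine Summable.of_norm_bounded ((summable_geometric_of_lt_one hβ0 hβ1).mul_right C) fun n => ?_
  rw [Real.norm_eq_abs, abs_mul, abs_of_nonneg (pow_nonneg hβ0 n)]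
  exact mul_le_mul_of_nonneg_left (he n) (pow_nonneg hβ0 n)

theorem summable_discounted (hβ0 : 0 ≤ β) (hβ1 : β < 1) {c : S → A → ℝ}
    (hc : IsBdd fun z : S × A => c z.1 z.2) :
    Summable fun n => β ^ n * expect (stateActionLaw step π p₀ n) fun z => c z.1 z.2 := by
  obtain ⟨C, hC⟩ := hc
  exact summable_discount hβ0 hβ1 fun n => abs_expect_le_const hC

theorem discounted_add (hβ0 : 0 ≤ β) (hβ1 : β < 1) {c d : S → A → ℝ}
    (hc : IsBdd fun z : S × A => c z.1 z.2) (hd : IsBdd fun z : S × A => d z.1 z.2) :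
    discounted β step (fun x u => c x u + d x u) π p₀ =
      discounted β step c π p₀ + discounted β step d π p₀ := by
  rw [discounted, discounted, discounted, ← (summable_discounted hβ0 hβ1 hc).tsum_add
    (summable_discounted hβ0 hβ1 hd)]
  exact tsum_congr fun n => by rw [expect_add hc hd, mul_add]

theorem discounted_const_mul (r : ℝ) (c : S → A → ℝ) :
    discounted β step (fun x u => r * c x u) π p₀ = r * discounted β step c π p₀ := by
  rw [discounted, discounted, ← tsum_mul_left]
  exact tsum_congr fun n => by rw [expect_const_mul]; ring

theorem discounted_nonneg (hβ0 : 0 ≤ β) {c : S → A → ℝ} (hc : ∀ x u, 0 ≤ c x u) :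
    0 ≤ discounted β step c π p₀ :=
  tsum_nonneg fun _ => mul_nonneg (pow_nonneg hβ0 _) (expect_nonneg fun _ _ => hc _ _)

theorem discounted_le (hβ0 : 0 ≤ β) (hβ1 : β < 1) {c : S → A → ℝ}
    (hc : IsBdd fun z : S × A => c z.1 z.2) {C : ℝ}
    (hC : ∀ h x, ∀ u ∈ (π h x).support, c x u ≤ C) :
    discounted β step c π p₀ ≤ C / (1 - β) := by
  rw [div_eq_mul_inv, ← tsum_geometric_of_lt_one hβ0 hβ1, mul_comm, ← tsum_mul_right]
  refine (summable_discounted hβ0 hβ1 hc).tsum_le_tsum (fun n => ?_)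
    ((summable_geometric_of_lt_one hβ0 hβ1).mul_right C)
  refine mul_le_mul_of_nonneg_left (expect_le_const hc fun z hz => ?_) (pow_nonneg hβ0 n)
  obtain ⟨h, hh⟩ := exists_of_mem_support_stateActionLaw hz
  exact hC h _ _ hh

theorem discounted_eq_of_forall (hβ0 : 0 ≤ β) (hβ1 : β < 1) {c : S → A → ℝ} {C : ℝ}
    (hC : ∀ h x, ∀ u ∈ (π h x).support, c x u = C) :
    discounted β step c π p₀ = C / (1 - β) := by
  rw [div_eq_mul_inv, ← tsum_geometric_of_lt_one hβ0 hβ1, mul_comm, ← tsum_mul_right]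
  refine tsum_congr fun n => ?_
  rw [expect_congr (g := fun _ => C), expect_const]
  intro z hz
  obtain ⟨h, hh⟩ := exists_of_mem_support_stateActionLaw hz
  exact hC h _ _ hh

/-- The excess of the cost of an action over the value `V` when `V` is used as the cost to go. -/
def bellmanGap (β : ℝ) (step : S → A → PMF S) (c : S → A → ℝ) (V : S → ℝ) (x : S) (u : A) : ℝ :=
  c x u + β * expect (step x u) V - V x

theorem isBdd_bellmanGap {c : S → A → ℝ} (hc : IsBdd fun z : S × A => c z.1 z.2) {V : S → ℝ}
    (hV : IsBdd V) : IsBdd fun z : S × A => bellmanGap β step c V z.1 z.2 :=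
  (hc.add ((isBdd_expect hV fun z : S × A => step z.1 z.2).const_mul β)).sub (hV.comp Prod.fst)

/-- The performance difference identity. -/
theorem discounted_eq_add_bellmanGap (hβ0 : 0 ≤ β) (hβ1 : β < 1) {c : S → A → ℝ}
    (hc : IsBdd fun z : S × A => c z.1 z.2) {V : S → ℝ} (hV : IsBdd V) :
    discounted β step c π p₀ =
      expect p₀ V + discounted β step (bellmanGap β step c V) π p₀ := by
  set e : ℕ → ℝ := fun n => expect (historyLaw step π p₀ n) fun h => V h.2 with he
  obtain ⟨B, hB⟩ := hV
  have hV : IsBdd V := ⟨B, hB⟩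
  have hs : Summable fun n => β ^ n * e n :=
    summable_discount hβ0 hβ1 fun n => abs_expect_le_const fun h => hB h.2
  have hs1 : Summable fun n => β ^ (n + 1) * e (n + 1) := (summable_nat_add_iff 1).2 hs
  have hgap : ∀ n, β ^ n * expect (stateActionLaw step π p₀ n)
        (fun z => bellmanGap β step c V z.1 z.2) =
      β ^ n * expect (stateActionLaw step π p₀ n) (fun z => c z.1 z.2) +
        (β ^ (n + 1) * e (n + 1) - β ^ n * e n) := by
    intro n
    have h1 := isBdd_expect hV (fun z : S × A => step z.1 z.2)
    simp only [bellmanGap]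
    rw [expect_sub (hc.add (h1.const_mul β)) (hV.comp Prod.fst), expect_add hc (h1.const_mul β),
      expect_const_mul, expect_stateActionLaw_fst hV, ← expect_historyLaw_succ hV]
    simp only [he]
    ring
  have h0 : ∑' n, β ^ n * e n = e 0 + ∑' n, β ^ (n + 1) * e (n + 1) := by
    rw [hs.tsum_eq_zero_add]
    simp
  have h2 : discounted β step (bellmanGap β step c V) π p₀ =
      discounted β step c π p₀ - e 0 := by
    rw [discounted, tsum_congr hgap, (summable_discounted hβ0 hβ1 hc).tsum_add (hs1.sub hs),
      hs1.tsum_sub hs, h0, discounted]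
    ring
  have h3 : e 0 = expect p₀ V := expect_historyLaw_zero hV
  linarith

/-- The law of the state after `n` transitions under a Markov kernel. -/
def stateLaw (k : S → PMF S) (p₀ : PMF S) : ℕ → PMF S
  | 0 => p₀
  | n + 1 => (stateLaw k p₀ n).bind k

theorem stateLaw_eq_of_invariant {k : S → PMF S} (h : p₀.bind k = p₀) (n : ℕ) :
    stateLaw k p₀ n = p₀ := by
  induction n with
  | zero => rfl
  | succ n ih => rw [stateLaw, ih, h]

theorem stateActionLaw_stationary (κ : S → PMF A) (n : ℕ) :
    stateActionLaw step (fun _ x => κ x) p₀ n =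
      (stateLaw (fun x => (κ x).bind (step x)) p₀ n).bind fun x => (κ x).map fun a => (x, a) := by
  suffices h : ∀ n, (historyLaw step (fun _ x => κ x) p₀ n).map Prod.snd =
      stateLaw (fun x => (κ x).bind (step x)) p₀ n by
    rw [stateActionLaw, ← h n, PMF.bind_map]
    rfl
  intro n
  induction n with
  | zero =>
    rw [historyLaw, PMF.map_comp, stateLaw]
    exact PMF.map_id _
  | succ n ih =>
    rw [historyLaw, stateLaw, ← ih, PMF.bind_map, PMF.map_bind]
    congr 1
    funext h
    simp only [PMF.map_bind, PMF.map_comp, Function.comp_apply]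
    congr 1
    funext a
    exact PMF.map_id _

/-- The law of a coin that shows `true` with probability `θ`. -/
def coin (θ : unitInterval) : PMF Bool :=
  PMF.ofFintype (fun b => ENNReal.ofReal (if b then θ else 1 - θ)) (by
    rw [Fintype.sum_bool, ← ENNReal.ofReal_add] <;> simp [θ.2.1, θ.2.2])

theorem coin_zero : coin 0 = PMF.pure false := by
  ext b
  cases b <;> simp [coin]

theorem coin_one : coin 1 = PMF.pure true := by
  ext b
  cases b <;> simp [coin]

theorem expect_coin (θ : unitInterval) (f : Bool → ℝ) :
    expect (coin θ) f = (1 - θ) * f false + θ * f true := by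
  rw [expect, tsum_fintype, Fintype.sum_bool]
  simp [coin, θ.2.1, θ.2.2, add_comm]

/-- With probability `θ` act by `σ₁`, otherwise by `σ₀`. -/
def mixture (σ₀ σ₁ : S → A) (θ : unitInterval) (x : S) : PMF A :=
  (coin θ).map fun b => if b then σ₁ x else σ₀ x

theorem mem_support_mixture {σ₀ σ₁ : S → A} {θ : unitInterval} {x : S} {u : A}
    (hu : u ∈ (mixture σ₀ σ₁ θ x).support) : u = σ₀ x ∨ u = σ₁ x := by
  simp only [mixture, PMF.mem_support_map_iff] at hu
  obtain ⟨b, -, rfl⟩ := hu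
  cases b <;> simp

theorem mixture_zero (σ₀ σ₁ : S → A) : mixture σ₀ σ₁ 0 = fun x => PMF.pure (σ₀ x) := by
  funext x
  simp [mixture, coin_zero, PMF.pure_map]

theorem mixture_one (σ₀ σ₁ : S → A) : mixture σ₀ σ₁ 1 = fun x => PMF.pure (σ₁ x) := by
  funext x
  simp [mixture, coin_one, PMF.pure_map]

theorem expect_mixture (σ₀ σ₁ : S → A) (θ : unitInterval) (x : S) {f : A → ℝ} (hf : IsBdd f) :
    expect (mixture σ₀ σ₁ θ x) f = (1 - θ) * f (σ₀ x) + θ * f (σ₁ x) := by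
  rw [mixture, expect_map _ hf, expect_coin]
  simp

theorem continuous_expect_stateLaw_mixture (σ₀ σ₁ : S → A) (n : ℕ) :
    ∀ f : S → ℝ, IsBdd f → Continuous fun θ : unitInterval =>
      expect (stateLaw (fun x => (mixture σ₀ σ₁ θ x).bind (step x)) p₀ n) f := by
  induction n with
  | zero =>
    intro f _
    simp only [stateLaw]
    exact continuous_const
  | succ n ih =>
    intro f hf
    have h0 := isBdd_expect hf fun x => step x (σ₀ x)
    have h1 := isBdd_expect hf fun x => step x (σ₁ x)
    simp only [stateLaw, expect_bind hf, expect_mixture _ _ _ _ (isBdd_expect hf _),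
      expect_add (h0.const_mul _) (h1.const_mul _), expect_const_mul]
    have h2 := ih _ h0
    have h3 := ih _ h1
    fun_prop

theorem continuous_discounted_mixture (hβ0 : 0 ≤ β) (hβ1 : β < 1) {c : S → A → ℝ}
    (hc : IsBdd fun z : S × A => c z.1 z.2) (σ₀ σ₁ : S → A) :
    Continuous fun θ : unitInterval =>
      discounted β step c (fun _ x => mixture σ₀ σ₁ θ x) p₀ := by
  have h0 : IsBdd fun x => c x (σ₀ x) := hc.comp fun x => (x, σ₀ x)
  have h1 : IsBdd fun x => c x (σ₁ x) := hc.comp fun x => (x, σ₁ x)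
  have hx : ∀ x, IsBdd fun u => c x u := fun x => hc.comp fun u => (x, u)
  obtain ⟨C, hC⟩ := id hc
  refine continuous_tsum (u := fun n => β ^ n * C) (fun n => ?_)
    ((summable_geometric_of_lt_one hβ0 hβ1).mul_right C) fun n θ => ?_
  · simp only [stateActionLaw_stationary, expect_bind hc, expect_map _ hc,
      expect_mixture _ _ _ _ (hx _), expect_add (h0.const_mul _) (h1.const_mul _), expect_const_mul]
    have h2 := continuous_expect_stateLaw_mixture (step := step) (p₀ := p₀) σ₀ σ₁ n _ h0
    have h3 := continuous_expect_stateLaw_mixture (step := step) (p₀ := p₀) σ₀ σ₁ n _ h1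
    fun_prop
  · rw [Real.norm_eq_abs, abs_mul, abs_of_nonneg (pow_nonneg hβ0 n)]
    exact mul_le_mul_of_nonneg_left (abs_expect_le_const hC) (pow_nonneg hβ0 n)

/-- Every discounted cost between those of two stationary policies is achieved by randomising
between the two. -/
theorem exists_policy_discounted_eq (hβ0 : 0 ≤ β) (hβ1 : β < 1) {c : S → A → ℝ}
    (hc : IsBdd fun z : S × A => c z.1 z.2) (σ₀ σ₁ : S → A) {a : ℝ}
    (h0 : discounted β step c (fun _ x => PMF.pure (σ₀ x)) p₀ ≤ a)
    (h1 : a ≤ discounted β step c (fun _ x => PMF.pure (σ₁ x)) p₀) :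
    ∃ π : Policy S A, discounted β step c π p₀ = a ∧
      ∀ h x, ∀ u ∈ (π h x).support, u = σ₀ x ∨ u = σ₁ x := by
  have hcont := continuous_discounted_mixture (step := step) (p₀ := p₀) hβ0 hβ1 hc σ₀ σ₁
  obtain ⟨θ, hθ⟩ := mem_range_of_exists_le_of_exists_ge hcont
    ⟨0, by simpa only [mixture_zero] using h0⟩ ⟨1, by simpa only [mixture_one] using h1⟩
  exact ⟨_, hθ, fun _ _ _ hu => mem_support_mixture hu⟩

end MDP

/-! ### Independent random variables -/

section Indep

variable {ι : Type} [Fintype ι] {α γ : Type*}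

theorem indep_apply (p : ι → PMF α) (x : ι → α) : indep p x = ∏ i, p i (x i) := rfl

theorem mem_support_indep {p : ι → PMF α} {x : ι → α} (hx : x ∈ (indep p).support) (i : ι) :
    x i ∈ (p i).support := by
  rw [PMF.mem_support_iff, indep_apply, Finset.prod_ne_zero_iff] at hx
  exact hx i (Finset.mem_univ i)

theorem indep_pure (x : ι → α) : indep (fun i => PMF.pure (x i)) = PMF.pure x := by
  classical
  ext y
  rw [indep_apply, PMF.pure_apply]
  split_ifs with h
  · simp [h]
  · obtain ⟨i, hi⟩ := Function.ne_iff.1 h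
    exact Finset.prod_eq_zero (Finset.mem_univ i) (by simp [PMF.pure_apply, hi])

theorem indep_bind (p : ι → PMF α) (k : ι → α → PMF γ) :
    ((indep p).bind fun x => indep fun i => k i (x i)) = indep fun i => (p i).bind (k i) := by
  ext y
  rw [PMF.bind_apply, indep_apply]
  simp only [PMF.bind_apply, indep_apply, ← Finset.prod_mul_distrib]
  exact tsum_pi_prod ι fun i a => p i a * k i a (y i)

theorem indep_map (p : ι → PMF α) (f : ι → α → γ) :
    ((indep p).map fun x i => f i (x i)) = indep fun i => (p i).map (f i) := by
  simp only [PMF.map, ← indep_bind, Function.comp_def, indep_pure]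

theorem indep_map_eval (p : ι → PMF α) (i : ι) : (indep p).map (fun x => x i) = p i := by
  classical
  ext a
  rw [PMF.map_apply]
  have h : ∀ x : ι → α, (if a = x i then indep p x else 0) =
      ∏ j, p j (x j) * if j = i then (if a = x j then 1 else 0) else 1 := by
    intro x
    rw [Finset.prod_mul_distrib, Finset.prod_ite_eq' Finset.univ i, indep_apply]
    simp
  rw [tsum_congr h, tsum_pi_prod ι fun j b => p j b * if j = i then (if a = b then 1 else 0) else 1,
    Finset.prod_eq_single i]
  · simp
  · intro j _ hj
    simp [hj, PMF.tsum_coe]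
  · simp

theorem expect_indep_eval (p : ι → PMF α) {f : α → ℝ} (hf : IsBdd f) (i : ι) :
    expect (indep p) (fun x => f (x i)) = expect (p i) f := by
  rw [← indep_map_eval p i, expect_map _ hf]

theorem expect_indep_sum (p : ι → PMF α) {f : ι → α → ℝ} (hf : ∀ i, IsBdd (f i)) :
    expect (indep p) (fun x => ∑ i, f i (x i)) = ∑ i, expect (p i) (f i) := by
  rw [expect_sum _ fun i _ => (hf i).comp _]
  exact Finset.sum_congr rfl fun i _ => expect_indep_eval p (hf i) i

theorem expect_indep_prod [Fintype α] (p : ι → PMF α) (g : ι → α → ℝ) :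
    expect (indep p) (fun x => ∏ i, g i (x i)) = ∏ i, expect (p i) (g i) := by
  classical
  simp only [expect, tsum_fintype, indep_apply, ENNReal.toReal_prod, ← Finset.prod_mul_distrib]
  rw [Finset.prod_univ_sum, Fintype.piFinset_univ]

/-- The variance of a sum of centred independent variables with values in `[-1, 1]`. -/
theorem expect_indep_sq_sum_le [Fintype α] (p : ι → PMF α) (g : ι → α → ℝ)
    (h0 : ∀ i, expect (p i) (g i) = 0) (h1 : ∀ i a, |g i a| ≤ 1) :
    expect (indep p) (fun x => (∑ i, g i (x i)) ^ 2) ≤ Fintype.card ι := by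
  classical
  have hb : ∀ i j, IsBdd fun x : ι → α => g i (x i) * g j (x j) := fun i j => .of_fintype _
  simp only [sq, Finset.sum_mul_sum]
  rw [expect_sum _ fun i _ => .sum _ fun j _ => hb i j]
  have hi : ∀ i, expect (indep p) (fun x => ∑ j, g i (x i) * g j (x j)) ≤ 1 := by
    intro i
    rw [expect_sum _ fun j _ => hb i j, Finset.sum_eq_single i]
    · refine expect_le_const (hb i i) fun x _ => ?_
      rw [← sq, ← sq_abs]
      exact pow_le_one₀ (abs_nonneg _) (h1 _ _)
    · intro j _ hj
      have h2 : ∀ x : ι → α, g i (x i) * g j (x j) =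
          ∏ l, (if l = i then g l (x l) else 1) * (if l = j then g l (x l) else 1) := by
        intro x
        rw [Finset.prod_mul_distrib, Finset.prod_ite_eq', Finset.prod_ite_eq']
        simp
      simp only [h2]
      rw [expect_indep_prod p fun l a => (if l = i then g l a else 1) * (if l = j then g l a else 1)]
      refine Finset.prod_eq_zero (Finset.mem_univ i) ?_
      simp [Ne.symm hj, h0]
    · simp
  simpa using Finset.sum_le_sum fun i (_ : i ∈ Finset.univ) => hi i

theorem expect_indep_abs_sum_le [Fintype α] (p : ι → PMF α) (g : ι → α → ℝ)
    (h0 : ∀ i, expect (p i) (g i) = 0) (h1 : ∀ i a, |g i a| ≤ 1) :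
    expect (indep p) (fun x => |∑ i, g i (x i)|) ≤ √(Fintype.card ι) := by
  rcases Nat.eq_zero_or_pos (Fintype.card ι) with hc | hc
  · have : IsEmpty ι := Fintype.card_eq_zero_iff.1 hc
    simp [expect_const]
  set s := √(Fintype.card ι : ℝ) with hs
  have hs0 : 0 < s := Real.sqrt_pos.2 (by exact_mod_cast hc)
  have hss : s ^ 2 = Fintype.card ι := Real.sq_sqrt (Nat.cast_nonneg _)
  have h2 : expect (indep p) (fun x => |∑ i, g i (x i)|) ≤
      expect (indep p) fun x => s / 2 + 1 / (2 * s) * (∑ i, g i (x i)) ^ 2 := by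
    refine expect_mono (.of_fintype _) (.of_fintype _) fun x _ => ?_
    have h3 := sq_nonneg (s - |∑ i, g i (x i)|)
    rw [sub_sq, sq_abs] at h3
    rw [div_add' _ _ _ (by positivity), le_div_iff₀ (by positivity)]
    field_simp
    linarith
  refine h2.trans ?_
  rw [expect_add (.of_fintype _) (.of_fintype _), expect_const, expect_const_mul]
  have h4 := mul_le_mul_of_nonneg_left (expect_indep_sq_sum_le p g h0 h1)
    (show 0 ≤ 1 / (2 * s) by positivity)
  have h5 : 1 / (2 * s) * (Fintype.card ι : ℝ) = s / 2 := by
    rw [← hss]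
    field_simp
  linarith

end Indep

/-! ### Couplings -/

section Coupling

variable {α : Type*}

open Classical in
/-- A coupling of two laws which is diagonal if the laws agree. -/
def couple (p q : PMF α) : PMF (α × α) :=
  if p = q then p.map fun a => (a, a) else p.bind fun a => q.map fun b => (a, b)

theorem couple_map_fst (p q : PMF α) : (couple p q).map Prod.fst = p := by
  unfold couple
  split_ifs with h
  · rw [PMF.map_comp]
    exact PMF.map_id p
  · simp only [PMF.map_bind, PMF.map_comp]
    simp

theorem couple_map_snd (p q : PMF α) : (couple p q).map Prod.snd = q := by
  unfold couple
  split_ifs with h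
  · rw [PMF.map_comp, ← h]
    exact PMF.map_id p
  · simp only [PMF.map_bind, PMF.map_comp, Function.comp_def]
    rw [PMF.bind_const]
    exact PMF.map_id q

theorem fst_eq_snd_of_mem_support_couple {p q : PMF α} (h : p = q) {z : α × α}
    (hz : z ∈ (couple p q).support) : z.1 = z.2 := by
  rw [couple, if_pos h, PMF.mem_support_map_iff] at hz
  obtain ⟨a, -, rfl⟩ := hz
  rfl

end Coupling

variable {N : ℕ}

/-! ### Entropy -/

theorem entropy_eq_sum_negMulLog (x : Belief N) :
    entropy x = ∑ k, Real.negMulLog (x k) / Real.log 2 := by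
  rw [entropy, ← Finset.sum_neg_distrib]
  refine Finset.sum_congr rfl fun k _ => ?_
  rw [Real.negMulLog, Real.logb]
  ring

theorem continuous_entropy : Continuous (entropy : Belief N → ℝ) := by
  have h : (entropy : Belief N → ℝ) = fun x => ∑ k, Real.negMulLog (x k) / Real.log 2 :=
    funext entropy_eq_sum_negMulLog
  rw [h]
  refine continuous_finsetSum _ fun k _ => Continuous.div_const ?_ _
  exact Real.continuous_negMulLog.comp ((continuous_apply k).comp continuous_subtype_val)

theorem isBdd_of_continuous {f : Belief N → ℝ} (hf : Continuous f) : IsBdd f :=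
  ⟨‖(⟨f, hf⟩ : C(Belief N, ℝ))‖, fun x => ContinuousMap.norm_coe_le_norm ⟨f, hf⟩ x⟩

theorem isBdd_entropy : IsBdd (entropy : Belief N → ℝ) := isBdd_of_continuous continuous_entropy

theorem entropy_nonneg (x : Belief N) : 0 ≤ entropy x := by
  rw [entropy_eq_sum_negMulLog]
  refine Finset.sum_nonneg fun k _ => div_nonneg (Real.negMulLog_nonneg (x.2.1 k) ?_)
    (Real.log_nonneg one_le_two)
  exact (Finset.single_le_sum (f := fun k => x k) (fun i _ => x.2.1 i) (Finset.mem_univ k)).trans_eq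
    x.2.2

/-- Concavity of a function on the simplex. -/
def IsConcave (f : Belief N → ℝ) : Prop :=
  ∀ a b : ℝ, 0 ≤ a → 0 ≤ b → a + b = 1 → ∀ x y z : Belief N, (∀ k, z k = a * x k + b * y k) →
    a * f x + b * f y ≤ f z

theorem isConcave_entropy : IsConcave (entropy : Belief N → ℝ) := by
  intro a b ha hb hab x y z hz
  simp only [entropy_eq_sum_negMulLog, Finset.mul_sum, ← Finset.sum_add_distrib]
  refine Finset.sum_le_sum fun k _ => ?_
  have h := Real.concaveOn_negMulLog.2 (x.2.1 k) (y.2.1 k) ha hb hab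
  simp only [smul_eq_mul] at h
  rw [hz, mul_div_assoc', mul_div_assoc', ← add_div]
  exact div_le_div_of_nonneg_right h (Real.log_nonneg one_le_two)

theorem IsConcave.sum_le {f : Belief N → ℝ} (hf : IsConcave f) (w : Belief N)
    (y : Fin N → Belief N) (z : Belief N) (hz : ∀ j, z j = ∑ k, w k * y k j) :
    ∑ k, w k * f (y k) ≤ f z := by
  classical
  set g : (Fin N → ℝ) → ℝ := fun v => if h : v ∈ stdSimplex ℝ (Fin N) then f ⟨v, h⟩ else 0 with hg
  have hgf : ∀ x : Belief N, g x.1 = f x := fun x => dif_pos x.2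
  have hconc : ConcaveOn ℝ (stdSimplex ℝ (Fin N)) g := by
    refine ⟨convex_stdSimplex ℝ _, fun x hx y hy a b ha hb hab => ?_⟩
    have h := hf a b ha hb hab ⟨x, hx⟩ ⟨y, hy⟩
      ⟨a • x + b • y, convex_stdSimplex ℝ _ hx hy ha hb hab⟩ fun k => rfl
    rwa [← hgf, ← hgf, ← hgf] at h
  have h := hconc.le_map_sum (t := Finset.univ) (w := fun k => w k) (p := fun k => (y k).1)
    (fun k _ => w.2.1 k) w.2.2 fun k _ => (y k).2
  have hz' : ∑ k, w k • (y k).1 = z.1 := by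
    funext j
    rw [Finset.sum_apply]
    exact (hz j).symm
  rw [hz', hgf] at h
  simpa only [hgf, smul_eq_mul] using h

/-! ### Dynamic programming for one bandit -/

namespace Source

variable (C : Source N) {β : ℝ}

theorem push_apply (x : Belief N) (j : Fin N) : C.push x j = ∑ k, x k * C.T k j := rfl

theorem continuous_push : Continuous C.push := by
  refine Continuous.subtype_mk (continuous_pi fun j => ?_) _
  change Continuous fun x : Belief N => ∑ k, x k * C.T k j
  refine continuous_finsetSum _ fun k _ => Continuous.mul ?_ continuous_const
  exact (continuous_apply k).comp continuous_subtype_val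

theorem expect_step_false (x : Belief N) (V : Belief N → ℝ) :
    expect (C.step x false) V = V (C.push x) := expect_pure _ _

theorem expect_step_true (x : Belief N) {V : Belief N → ℝ} (hV : IsBdd V) :
    expect (C.step x true) V = (1 - C.ρ) * V (C.push x) + C.ρ * ∑ k, x k * V (C.obs k) := by
  have h0 : ∀ k : Fin N, 0 ≤ x k := x.2.1
  rw [step, expect_map _ hV, expect, tsum_fintype, Fintype.sum_option]
  simp only [reception, PMF.ofFintype_apply, Option.elim]
  rw [ENNReal.toReal_ofReal (sub_nonneg.2 C.ρ_le_one), Finset.mul_sum]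
  congr 1
  refine Finset.sum_congr rfl fun k _ => ?_
  rw [ENNReal.toReal_ofReal (mul_nonneg C.ρ_pos.le (h0 k)), mul_assoc]

/-- The Bellman operator of the single bandit problem with service charge `lam`. -/
def bellman (β lam : ℝ) (f : C(Belief N, ℝ)) : C(Belief N, ℝ) where
  toFun x := entropy x + min
    (lam + β * ((1 - C.ρ) * f (C.push x) + C.ρ * ∑ k, x k * f (C.obs k))) (β * f (C.push x))
  continuous_toFun := by
    have h2 : Continuous fun x => f (C.push x) := f.continuous.comp C.continuous_push
    have h3 : Continuous fun x : Belief N => ∑ k, x k * f (C.obs k) :=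
      continuous_finsetSum _ fun k _ =>
        ((continuous_apply k).comp continuous_subtype_val).mul continuous_const
    exact continuous_entropy.add ((continuous_const.add (continuous_const.mul
      ((continuous_const.mul h2).add (continuous_const.mul h3)))).min (continuous_const.mul h2))

theorem bellman_apply (β lam : ℝ) (f : C(Belief N, ℝ)) (x : Belief N) :
    C.bellman β lam f x = entropy x + min
      (lam + β * ((1 - C.ρ) * f (C.push x) + C.ρ * ∑ k, x k * f (C.obs k)))
      (β * f (C.push x)) := rfl

theorem contractingWith_bellman (hβ0 : 0 ≤ β) (hβ1 : β < 1) (lam : ℝ) :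
    ContractingWith ⟨β, hβ0⟩ (C.bellman β lam) := by
  refine ⟨by exact_mod_cast hβ1, LipschitzWith.of_dist_le_mul fun f g => ?_⟩
  have hd : ∀ x, |f x - g x| ≤ dist f g := fun x => by
    rw [← Real.dist_eq]
    exact ContinuousMap.dist_apply_le_dist x
  refine (ContinuousMap.dist_le (C := β * dist f g) (mul_nonneg hβ0 dist_nonneg)).2 ?_
  intro x
  have hx0 : ∀ k, 0 ≤ x k := x.2.1
  have hx1 : ∑ k, x k = 1 := x.2.2
  rw [Real.dist_eq, bellman_apply, bellman_apply, add_sub_add_left_eq_sub]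
  refine (abs_min_sub_min_le_max _ _ _ _).trans (max_le ?_ ?_)
  · have h1 : |(∑ k, x k * f (C.obs k)) - ∑ k, x k * g (C.obs k)| ≤ dist f g := by
      rw [← Finset.sum_sub_distrib, ← one_mul (dist f g), ← hx1, Finset.sum_mul]
      refine (Finset.abs_sum_le_sum_abs _ _).trans (Finset.sum_le_sum fun k _ => ?_)
      rw [← mul_sub, abs_mul, abs_of_nonneg (hx0 k)]
      exact mul_le_mul_of_nonneg_left (hd _) (hx0 k)
    have h2 := hd (C.push x)
    have e : lam + β * ((1 - C.ρ) * f (C.push x) + C.ρ * ∑ k, x k * f (C.obs k)) -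
        (lam + β * ((1 - C.ρ) * g (C.push x) + C.ρ * ∑ k, x k * g (C.obs k))) =
        β * ((1 - C.ρ) * (f (C.push x) - g (C.push x)) +
          C.ρ * ((∑ k, x k * f (C.obs k)) - ∑ k, x k * g (C.obs k))) := by ring
    rw [e, abs_mul, abs_of_nonneg hβ0]
    refine mul_le_mul_of_nonneg_left ((abs_add_le _ _).trans ?_) hβ0
    rw [abs_mul, abs_mul, abs_of_nonneg (sub_nonneg.2 C.ρ_le_one), abs_of_pos C.ρ_pos]
    have h3 := mul_le_mul_of_nonneg_left h2 (sub_nonneg.2 C.ρ_le_one)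
    have h4 := mul_le_mul_of_nonneg_left h1 C.ρ_pos.le
    linarith
  · rw [← mul_sub, abs_mul, abs_of_nonneg hβ0]
    exact mul_le_mul_of_nonneg_left (hd _) hβ0

theorem isConcave_bellman (hβ0 : 0 ≤ β) (lam : ℝ) {f : C(Belief N, ℝ)} (hf : IsConcave f) :
    IsConcave (C.bellman β lam f) := by
  intro a b ha hb hab x y z hz
  have h1 := isConcave_entropy a b ha hb hab x y z hz
  have h2 := hf a b ha hb hab (C.push x) (C.push y) (C.push z) fun j => by
    simp only [push_apply, Finset.mul_sum, ← Finset.sum_add_distrib, hz]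
    exact Finset.sum_congr rfl fun k _ => by ring
  have h3 : ∑ k, z k * f (C.obs k) =
      a * ∑ k, x k * f (C.obs k) + b * ∑ k, y k * f (C.obs k) := by
    simp only [Finset.mul_sum, ← Finset.sum_add_distrib, hz]
    exact Finset.sum_congr rfl fun k _ => by ring
  simp only [bellman_apply, mul_add]
  suffices h : a * min (lam + β * ((1 - C.ρ) * f (C.push x) + C.ρ * ∑ k, x k * f (C.obs k)))
        (β * f (C.push x)) + b * min (lam + β * ((1 - C.ρ) * f (C.push y) +
          C.ρ * ∑ k, y k * f (C.obs k))) (β * f (C.push y)) ≤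
      min (lam + β * ((1 - C.ρ) * f (C.push z) + C.ρ * ∑ k, z k * f (C.obs k)))
        (β * f (C.push z)) by
    simp only [mul_add] at h
    linarith
  refine le_min ?_ ?_
  · have h4 := mul_le_mul_of_nonneg_left (min_le_left
      (lam + β * ((1 - C.ρ) * f (C.push x) + C.ρ * ∑ k, x k * f (C.obs k))) (β * f (C.push x))) ha
    have h5 := mul_le_mul_of_nonneg_left (min_le_left
      (lam + β * ((1 - C.ρ) * f (C.push y) + C.ρ * ∑ k, y k * f (C.obs k))) (β * f (C.push y))) hb
    have h6 := mul_le_mul_of_nonneg_left h2 (mul_nonneg hβ0 (sub_nonneg.2 C.ρ_le_one))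
    have h7 : lam = a * lam + b * lam := by rw [← add_mul, hab, one_mul]
    rw [h3]
    linarith
  · have h4 := mul_le_mul_of_nonneg_left (min_le_right
      (lam + β * ((1 - C.ρ) * f (C.push x) + C.ρ * ∑ k, x k * f (C.obs k))) (β * f (C.push x))) ha
    have h5 := mul_le_mul_of_nonneg_left (min_le_right
      (lam + β * ((1 - C.ρ) * f (C.push y) + C.ρ * ∑ k, y k * f (C.obs k))) (β * f (C.push y))) hb
    have h6 := mul_le_mul_of_nonneg_left h2 hβ0
    linarith

theorem exists_bellman_fixedPoint (hβ0 : 0 ≤ β) (hβ1 : β < 1) (lam : ℝ) :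
    ∃ f : C(Belief N, ℝ), C.bellman β lam f = f ∧ IsConcave f := by
  have hc := C.contractingWith_bellman hβ0 hβ1 lam
  refine ⟨hc.fixedPoint, hc.fixedPoint_isFixedPt, fun a b ha hb hab x y z hz => ?_⟩
  have hit : ∀ n, IsConcave ((C.bellman β lam)^[n] 0) := by
    intro n
    induction n with
    | zero => intro a b _ _ _ x y z _; simp
    | succ n ih =>
      rw [Function.iterate_succ_apply']
      exact C.isConcave_bellman hβ0 lam ih
  have ht := hc.tendsto_iterate_fixedPoint 0
  have hx : ∀ w, Tendsto (fun n => (C.bellman β lam)^[n] 0 w) atTop (𝓝 (hc.fixedPoint _ w)) :=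
    fun w => ((continuous_eval_const w).tendsto _).comp ht
  exact le_of_tendsto_of_tendsto' (((hx x).const_mul a).add ((hx y).const_mul b)) (hx z)
    fun n => hit n a b ha hb hab x y z hz

/-- Cost per slot of the single bandit problem with service charge `lam`. -/
def stageCost (lam : ℝ) (y : Belief N) (u : Bool) : ℝ := entropy y + if u then lam else 0

theorem isBdd_stageCost (lam : ℝ) :
    IsBdd fun z : Belief N × Bool => stageCost lam z.1 z.2 :=
  (isBdd_entropy.comp Prod.fst).add ((IsBdd.of_fintype fun u : Bool => if u then lam else 0).comp
    Prod.snd)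

/-- The excess cost of an action in the single bandit problem with service charge `lam`. -/
def gap (β lam : ℝ) (x : Belief N) (u : Bool) : ℝ :=
  bellmanGap β C.step (stageCost lam) (C.value β lam) x u

variable {C} in
theorem value_eq_of_bellman_eq (hβ0 : 0 ≤ β) (hβ1 : β < 1) {lam : ℝ} {f : C(Belief N, ℝ)}
    (hf : C.bellman β lam f = f) : C.value β lam = f := by
  classical
  have hfb : IsBdd f := isBdd_of_continuous f.continuous
  have hfx : ∀ x, f x = min (stageCost lam x true + β * expect (C.step x true) f)
      (stageCost lam x false + β * expect (C.step x false) f) := by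
    intro x
    nth_rewrite 1 [← hf]
    rw [bellman_apply, C.expect_step_true x hfb, C.expect_step_false, ← min_add_add_left]
    simp [stageCost, add_assoc]
  have hgap : ∀ x u, 0 ≤ bellmanGap β C.step (stageCost lam) f x u := by
    intro x u
    have h := hfx x
    rw [bellmanGap, sub_nonneg]
    cases u
    · exact h.trans_le (min_le_right _ _)
    · exact h.trans_le (min_le_left _ _)
  have hex : ∀ x, ∃ u, bellmanGap β C.step (stageCost lam) f x u = 0 := by
    intro x
    rcases min_choice (stageCost lam x true + β * expect (C.step x true) f)
      (stageCost lam x false + β * expect (C.step x false) f) with h | h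
    · exact ⟨true, by rw [bellmanGap, sub_eq_zero, hfx x, h]⟩
    · exact ⟨false, by rw [bellmanGap, sub_eq_zero, hfx x, h]⟩
  choose σ hσ using hex
  funext x
  have hid : ∀ π : Policy (Belief N) Bool, discounted β C.step (stageCost lam) π (PMF.pure x) =
      f x + discounted β C.step (bellmanGap β C.step (stageCost lam) f) π (PMF.pure x) := by
    intro π
    rw [discounted_eq_add_bellmanGap hβ0 hβ1 (isBdd_stageCost lam) hfb, expect_pure]
  have hlow : ∀ π : Policy (Belief N) Bool,
      f x ≤ discounted β C.step (stageCost lam) π (PMF.pure x) := by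
    intro π
    rw [hid]
    exact le_add_of_nonneg_right (discounted_nonneg hβ0 hgap)
  refine le_antisymm ?_ (le_ciInf hlow)
  refine (ciInf_le ⟨f x, ?_⟩ (fun _ y => PMF.pure (σ y))).trans_eq ((hid _).trans ?_)
  · rintro _ ⟨π, rfl⟩
    exact hlow π
  · rw [discounted_eq_of_forall (C := 0) hβ0 hβ1]
    · simp
    · intro h y u hu
      rw [PMF.mem_support_pure_iff] at hu
      rw [hu, hσ]

theorem value_spec (hβ0 : 0 ≤ β) (hβ1 : β < 1) (lam : ℝ) :
    ∃ f : C(Belief N, ℝ), C.bellman β lam f = f ∧ IsConcave f ∧ C.value β lam = f := by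
  obtain ⟨f, hf, hc⟩ := C.exists_bellman_fixedPoint hβ0 hβ1 lam
  exact ⟨f, hf, hc, value_eq_of_bellman_eq hβ0 hβ1 hf⟩

theorem isBdd_value (hβ0 : 0 ≤ β) (hβ1 : β < 1) (lam : ℝ) : IsBdd (C.value β lam) := by
  obtain ⟨f, -, -, hf⟩ := C.value_spec hβ0 hβ1 lam
  rw [hf]
  exact isBdd_of_continuous f.continuous

theorem gainIndex_nonneg (hβ0 : 0 ≤ β) (hβ1 : β < 1) (lam : ℝ) (x : Belief N) :
    0 ≤ C.gainIndex β lam x := by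
  obtain ⟨f, -, hc, hf⟩ := C.value_spec hβ0 hβ1 lam
  rw [gainIndex, hf]
  exact mul_nonneg C.ρ_pos.le (sub_nonneg.2 (hc.sum_le x C.obs (C.push x) fun j => rfl))

theorem gap_true (hβ0 : 0 ≤ β) (hβ1 : β < 1) (lam : ℝ) (x : Belief N) :
    C.gap β lam x true = C.gap β lam x false + (lam - β * C.gainIndex β lam x) := by
  simp only [gap, bellmanGap, C.expect_step_true x (C.isBdd_value hβ0 hβ1 lam),
    C.expect_step_false, stageCost, gainIndex]
  simp only [if_true, Bool.false_eq_true, if_false]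
  ring

theorem min_gap (hβ0 : 0 ≤ β) (hβ1 : β < 1) (lam : ℝ) (x : Belief N) :
    min (C.gap β lam x true) (C.gap β lam x false) = 0 := by
  have hb := C.isBdd_value hβ0 hβ1 lam
  obtain ⟨f, hfix, -, hf⟩ := C.value_spec hβ0 hβ1 lam
  have h : C.value β lam x = C.bellman β lam f x := by rw [hfix, hf]
  rw [bellman_apply, ← hf] at h
  simp only [gap, bellmanGap, C.expect_step_true x hb, C.expect_step_false, stageCost]
  rw [min_sub_sub_right, h, ← min_add_add_left]
  simp [add_assoc]

theorem gap_nonneg (hβ0 : 0 ≤ β) (hβ1 : β < 1) (lam : ℝ) (x : Belief N) (u : Bool) :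
    0 ≤ C.gap β lam x u := by
  have h := C.min_gap hβ0 hβ1 lam x
  cases u
  · exact h.symm.trans_le (min_le_right _ _)
  · exact h.symm.trans_le (min_le_left _ _)

theorem isBdd_gap (hβ0 : 0 ≤ β) (hβ1 : β < 1) (lam : ℝ) :
    IsBdd fun z : Belief N × Bool => C.gap β lam z.1 z.2 :=
  isBdd_bellmanGap (isBdd_stageCost lam) (C.isBdd_value hβ0 hβ1 lam)

open Classical in
/-- The action that is active exactly when the discounted gain index is at least the charge. -/
def greedy (β lam : ℝ) (x : Belief N) : Bool := decide (lam ≤ β * C.gainIndex β lam x)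

theorem gap_greedy (hβ0 : 0 ≤ β) (hβ1 : β < 1) (lam : ℝ) (x : Belief N) :
    C.gap β lam x (C.greedy β lam x) = 0 := by
  have h := C.min_gap hβ0 hβ1 lam x
  have h1 := C.gap_true hβ0 hβ1 lam x
  by_cases hl : lam ≤ β * C.gainIndex β lam x
  · rw [greedy, decide_eq_true hl]
    rwa [min_eq_left (by linarith)] at h
  · rw [greedy, decide_eq_false hl]
    rwa [min_eq_right (by linarith)] at h

theorem greedy_of_nonpos (hβ0 : 0 ≤ β) (hβ1 : β < 1) {lam : ℝ} (hl : lam ≤ 0) (x : Belief N) :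
    C.greedy β lam x = true :=
  decide_eq_true (hl.trans (mul_nonneg hβ0 (C.gainIndex_nonneg hβ0 hβ1 lam x)))

theorem le_of_gap_true_eq_zero (hβ0 : 0 ≤ β) (hβ1 : β < 1) {lam : ℝ} {x : Belief N}
    (h : C.gap β lam x true = 0) : lam ≤ β * C.gainIndex β lam x := by
  have h1 := C.gap_true hβ0 hβ1 lam x
  have h2 := C.gap_nonneg hβ0 hβ1 lam x false
  linarith

theorem le_of_gap_false_eq_zero (hβ0 : 0 ≤ β) (hβ1 : β < 1) {lam : ℝ} {x : Belief N}
    (h : C.gap β lam x false = 0) : β * C.gainIndex β lam x ≤ lam := by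
  have h1 := C.gap_true hβ0 hβ1 lam x
  have h2 := C.gap_nonneg hβ0 hβ1 lam x true
  linarith

theorem value_le_value_add (hβ0 : 0 ≤ β) (hβ1 : β < 1) (lam lam' : ℝ) (x : Belief N) :
    C.value β lam x ≤ C.value β lam' x + |lam - lam'| / (1 - β) := by
  have hid : ∀ l, discounted β C.step (stageCost l) (fun _ y => PMF.pure (C.greedy β lam' y))
      (PMF.pure x) = C.value β l x + discounted β C.step (C.gap β l)
        (fun _ y => PMF.pure (C.greedy β lam' y)) (PMF.pure x) := by
    intro l
    rw [discounted_eq_add_bellmanGap hβ0 hβ1 (isBdd_stageCost l) (C.isBdd_value hβ0 hβ1 l),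
      expect_pure]
    rfl
  have h1 := hid lam
  have h2 := hid lam'
  have h3 : discounted β C.step (C.gap β lam') (fun _ y => PMF.pure (C.greedy β lam' y))
      (PMF.pure x) = 0 := by
    rw [discounted_eq_of_forall (C := 0) hβ0 hβ1, zero_div]
    intro h y u hu
    rw [PMF.mem_support_pure_iff] at hu
    rw [hu, C.gap_greedy hβ0 hβ1]
  have h4 : 0 ≤ discounted β C.step (C.gap β lam) (fun _ y => PMF.pure (C.greedy β lam' y))
      (PMF.pure x) := discounted_nonneg hβ0 (C.gap_nonneg hβ0 hβ1 lam)
  have hb : IsBdd fun z : Belief N × Bool => if z.2 then lam - lam' else 0 :=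
    (IsBdd.of_fintype fun u : Bool => if u then lam - lam' else 0).comp Prod.snd
  have h5 : discounted β C.step (stageCost lam) (fun _ y => PMF.pure (C.greedy β lam' y))
        (PMF.pure x) =
      discounted β C.step (stageCost lam') (fun _ y => PMF.pure (C.greedy β lam' y))
        (PMF.pure x) + discounted β C.step (fun _ u => if u then lam - lam' else 0)
          (fun _ y => PMF.pure (C.greedy β lam' y)) (PMF.pure x) := by
    rw [← discounted_add hβ0 hβ1 (isBdd_stageCost lam') hb]
    congr 1
    funext y u
    cases u <;> simp [stageCost]
  have h6 : discounted β C.step (fun _ u => if u then lam - lam' else 0)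
      (fun _ y => PMF.pure (C.greedy β lam' y)) (PMF.pure x) ≤ |lam - lam'| / (1 - β) := by
    refine discounted_le hβ0 hβ1 hb fun _ _ u _ => ?_
    cases u
    · simp
    · simpa using le_abs_self (lam - lam')
  linarith

theorem gap_greedy_le (hβ0 : 0 ≤ β) (hβ1 : β < 1) (lam lam' : ℝ) (x : Belief N) :
    C.gap β lam x (C.greedy β lam' x) ≤ (1 + 2 / (1 - β)) * |lam - lam'| := by
  rw [← sub_zero (C.gap β lam x _), ← C.gap_greedy hβ0 hβ1 lam' x]
  have hb := C.isBdd_value hβ0 hβ1 lam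
  have hb' := C.isBdd_value hβ0 hβ1 lam'
  have h1β : 0 < 1 - β := sub_pos.2 hβ1
  set u := C.greedy β lam' x
  set d := |lam - lam'| with hd
  have hd0 : 0 ≤ d := abs_nonneg _
  have h1 : stageCost lam x u - stageCost lam' x u ≤ d := by
    cases u
    · simpa [stageCost] using hd0
    · simpa [stageCost] using le_abs_self (lam - lam')
  have h2 : expect (C.step x u) (C.value β lam) ≤
      expect (C.step x u) (C.value β lam') + d / (1 - β) := by
    rw [← expect_const (C.step x u) (d / (1 - β)), ← expect_add hb' (.const _)]
    exact expect_mono hb (hb'.add (.const _)) fun y _ => C.value_le_value_add hβ0 hβ1 lam lam' y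
  have h3 := C.value_le_value_add hβ0 hβ1 lam' lam x
  rw [abs_sub_comm, ← hd] at h3
  have h4 := mul_le_mul_of_nonneg_left h2 hβ0
  have h5 : β * (d / (1 - β)) ≤ d / (1 - β) :=
    mul_le_of_le_one_left (div_nonneg hd0 h1β.le) hβ1.le
  have h6 : (1 + 2 / (1 - β)) * d = d + d / (1 - β) + d / (1 - β) := by ring
  simp only [gap, bellmanGap]
  linarith

end Source

variable {Q : ℕ} {source : Fin Q → Source N}

/-! ### Lagrangian duality for the relaxed problem -/

theorem mem_support_stateActionLaw_zero {S A : Type*} {step : S → A → PMF S} {κ : S → PMF A}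
    {p₀ : PMF S} {x : S} {u : A} (hx : x ∈ p₀.support) (hu : u ∈ (κ x).support) :
    (x, u) ∈ (stateActionLaw step (fun _ x => κ x) p₀ 0).support := by
  rw [stateActionLaw_stationary, stateLaw, PMF.mem_support_bind_iff]
  exact ⟨x, hx, (PMF.mem_support_map_iff _ _ _).2 ⟨u, hu, rfl⟩⟩

theorem eq_zero_of_discounted_eq_zero {S A : Type*} {β : ℝ} (hβ0 : 0 ≤ β) (hβ1 : β < 1)
    {step : S → A → PMF S} {κ : S → PMF A} {p₀ : PMF S} {c : S → A → ℝ}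
    (hc : IsBdd fun z : S × A => c z.1 z.2) (h0 : ∀ x u, 0 ≤ c x u)
    (h : discounted β step c (fun _ x => κ x) p₀ = 0) {x : S} {u : A} (hx : x ∈ p₀.support)
    (hu : u ∈ (κ x).support) : c x u = 0 := by
  have hs := (summable_discounted (step := step) (π := fun _ x => κ x) (p₀ := p₀) hβ0 hβ1 hc).hasSum
  rw [← discounted, h] at hs
  have h1 := congrFun ((hasSum_zero_iff_of_nonneg fun n => mul_nonneg (pow_nonneg hβ0 n)
    (expect_nonneg fun _ _ => h0 _ _)).1 hs) 0
  rw [Pi.zero_apply, pow_zero, one_mul] at h1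
  exact eq_zero_of_expect_eq_zero hc (fun _ _ => h0 _ _) h1 _
    (mem_support_stateActionLaw_zero hx hu)

namespace RMAB

variable (R : RMAB source) {β : ℝ} {μ : Fin Q → PMF (Belief N)}

theorem expect_step_sum (x : R.State) (u : R.Action) {f : Fin R.M → Belief N → ℝ}
    (hf : ∀ i, IsBdd (f i)) :
    expect (R.step x u) (fun y => ∑ i, f i (y i)) =
      ∑ i, expect ((R.src i).step (x i) (u i)) (f i) :=
  expect_indep_sum _ hf

theorem isBdd_sum_entropy : IsBdd fun x : R.State => ∑ i, entropy (x i) :=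
  .sum _ fun _ _ => isBdd_entropy.comp _

/-- Cost per slot with service charge `lam`. -/
def stageCost (lam : ℝ) (x : R.State) (u : R.Action) : ℝ :=
  ∑ i, Source.stageCost lam (x i) (u i)

theorem isBdd_stageCost (lam : ℝ) :
    IsBdd fun z : R.State × R.Action => R.stageCost lam z.1 z.2 :=
  .sum _ fun i _ => (Source.isBdd_stageCost lam).comp
    fun z : R.State × R.Action => (z.1 i, z.2 i)

/-- Sum of the single bandit values. -/
def sumValue (β lam : ℝ) (x : R.State) : ℝ := ∑ i, (R.src i).value β lam (x i)

/-- Sum of the single bandit excess costs. -/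
def sumGap (β lam : ℝ) (x : R.State) (u : R.Action) : ℝ := ∑ i, (R.src i).gap β lam (x i) (u i)

theorem bellmanGap_sumValue (hβ0 : 0 ≤ β) (hβ1 : β < 1) (lam : ℝ) :
    bellmanGap β R.step (R.stageCost lam) (R.sumValue β lam) = R.sumGap β lam := by
  funext x u
  have h : expect (R.step x u) (R.sumValue β lam) =
      ∑ i, expect ((R.src i).step (x i) (u i)) ((R.src i).value β lam) :=
    R.expect_step_sum x u fun i => (R.src i).isBdd_value hβ0 hβ1 lam
  simp only [bellmanGap, h, sumValue, sumGap, stageCost, Source.gap, Finset.sum_sub_distrib,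
    Finset.sum_add_distrib, Finset.mul_sum]

theorem isBdd_sumGap (hβ0 : 0 ≤ β) (hβ1 : β < 1) (lam : ℝ) :
    IsBdd fun z : R.State × R.Action => R.sumGap β lam z.1 z.2 :=
  .sum _ fun i _ => ((R.src i).isBdd_gap hβ0 hβ1 lam).comp
    fun z : R.State × R.Action => (z.1 i, z.2 i)

theorem sumGap_nonneg (hβ0 : 0 ≤ β) (hβ1 : β < 1) (lam : ℝ) (x : R.State) (u : R.Action) :
    0 ≤ R.sumGap β lam x u :=
  Finset.sum_nonneg fun _ _ => Source.gap_nonneg _ hβ0 hβ1 lam _ _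

theorem isBdd_active : IsBdd fun z : R.State × R.Action => (R.active z.2 : ℝ) :=
  (IsBdd.of_fintype fun u : R.Action => (R.active u : ℝ)).comp Prod.snd

theorem active_eq_sum (u : R.Action) : (R.active u : ℝ) = ∑ i, if u i then 1 else 0 := by
  rw [active, Finset.card_filter]
  push_cast
  rfl

theorem stageCost_eq (lam : ℝ) (x : R.State) (u : R.Action) :
    R.stageCost lam x u = ∑ i, entropy (x i) + lam * R.active u := by
  rw [stageCost, active_eq_sum, Finset.mul_sum, ← Finset.sum_add_distrib]
  exact Finset.sum_congr rfl fun i _ => by simp [Source.stageCost]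

/-- The Lagrangian of the relaxed problem, in terms of the values and the excess costs of the single
bandits. -/
theorem cost_add_mul_usage (hβ0 : 0 ≤ β) (hβ1 : β < 1) (lam : ℝ) (p₀ : PMF R.State)
    (π : Policy R.State R.Action) :
    R.cost β p₀ π + lam * R.usage β p₀ π =
      expect p₀ (R.sumValue β lam) + discounted β R.step (R.sumGap β lam) π p₀ := by
  have hV : IsBdd (R.sumValue β lam) :=
    .sum _ fun i _ => ((R.src i).isBdd_value hβ0 hβ1 lam).comp fun x : R.State => x i
  rw [← R.bellmanGap_sumValue hβ0 hβ1,
    ← discounted_eq_add_bellmanGap hβ0 hβ1 (R.isBdd_stageCost lam) hV, cost, usage,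
    ← discounted_const_mul, ← discounted_add hβ0 hβ1 (R.isBdd_sum_entropy.comp Prod.fst)
      (R.isBdd_active.const_mul lam)]
  congr 1
  funext x u
  exact (R.stageCost_eq lam x u).symm

theorem expect_initial_sumValue (hβ0 : 0 ≤ β) (hβ1 : β < 1) (lam : ℝ) :
    expect (R.initial μ) (R.sumValue β lam) = R.dual β μ lam + lam * (R.m / (1 - β)) := by
  unfold sumValue initial
  rw [expect_indep_sum _ fun i => (R.src i).isBdd_value hβ0 hβ1 lam, dual]
  ring

/-- All bandits act greedily for the charge `lam`. -/
def greedy (β lam : ℝ) (x : R.State) : R.Action := fun i => (R.src i).greedy β lam (x i)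

theorem sumGap_greedy (hβ0 : 0 ≤ β) (hβ1 : β < 1) (lam : ℝ) (x : R.State) :
    R.sumGap β lam x (R.greedy β lam x) = 0 :=
  Finset.sum_eq_zero fun i _ => (R.src i).gap_greedy hβ0 hβ1 lam (x i)

theorem sumGap_greedy_le (hβ0 : 0 ≤ β) (hβ1 : β < 1) (lam lam' : ℝ) (x : R.State) :
    R.sumGap β lam x (R.greedy β lam' x) ≤ R.M * ((1 + 2 / (1 - β)) * |lam - lam'|) := by
  refine (Finset.sum_le_sum fun i _ =>
    (R.src i).gap_greedy_le hβ0 hβ1 lam lam' (x i)).trans_eq ?_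
  simp

variable {R} in
theorem IsOptimalCharge.usage_greedy {lam : ℝ} (hlam : R.IsOptimalCharge β μ lam) (hβ0 : 0 ≤ β)
    (hβ1 : β < 1) {l : ℝ} (hl : 0 ≤ l) :
    (l - lam) * R.usage β (R.initial μ) (fun _ x => PMF.pure (R.greedy β l x)) ≤
      (l - lam) * (R.m / (1 - β)) := by
  set σ : Policy R.State R.Action := fun _ x => PMF.pure (R.greedy β l x) with hσ
  have h1 := R.cost_add_mul_usage hβ0 hβ1 l (R.initial μ) σ
  have h2 := R.cost_add_mul_usage hβ0 hβ1 lam (R.initial μ) σ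
  have h3 : discounted β R.step (R.sumGap β l) σ (R.initial μ) = 0 := by
    rw [discounted_eq_of_forall (C := 0) hβ0 hβ1, zero_div]
    intro h x u hu
    rw [hσ, PMF.mem_support_pure_iff] at hu
    rw [hu, R.sumGap_greedy hβ0 hβ1]
  have h4 : 0 ≤ discounted β R.step (R.sumGap β lam) σ (R.initial μ) :=
    discounted_nonneg hβ0 (R.sumGap_nonneg hβ0 hβ1 lam)
  have h5 := hlam.2 l hl
  rw [R.expect_initial_sumValue hβ0 hβ1] at h1 h2
  linarith

theorem usage_greedy_of_nonpos (hβ0 : 0 ≤ β) (hβ1 : β < 1) {l : ℝ} (hl : l ≤ 0)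
    (p₀ : PMF R.State) :
    R.usage β p₀ (fun _ x => PMF.pure (R.greedy β l x)) = R.M / (1 - β) := by
  refine discounted_eq_of_forall hβ0 hβ1 fun h x u hu => ?_
  rw [PMF.mem_support_pure_iff] at hu
  have : u = fun _ => true := by
    rw [hu]
    funext i
    exact (R.src i).greedy_of_nonpos hβ0 hβ1 hl _
  simp [this, active]

variable {R} in
/-- Strong duality: for an optimal charge some feasible policy of the relaxed problem almost
attains the dual bound. -/
theorem IsOptimalCharge.exists_relaxedAdmissible {lam : ℝ} (hlam : R.IsOptimalCharge β μ lam)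
    (hβ0 : 0 ≤ β) (hβ1 : β < 1) (hm : R.m ≤ R.M) {ε : ℝ} (hε : 0 < ε) :
    ∃ π : Policy R.State R.Action, R.RelaxedAdmissible β (R.initial μ) π ∧
      discounted β R.step (R.sumGap β lam) π (R.initial μ) ≤
        R.M * ((1 + 2 / (1 - β)) * ε) / (1 - β) := by
  have h1β : 0 < 1 - β := sub_pos.2 hβ1
  have hlow : R.usage β (R.initial μ) (fun _ x => PMF.pure (R.greedy β (lam + ε) x)) ≤
      R.m / (1 - β) := by
    have h := hlam.usage_greedy hβ0 hβ1 (add_nonneg hlam.1 hε.le)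
    rw [add_sub_cancel_left] at h
    exact le_of_mul_le_mul_left h hε
  have hhigh : R.m / (1 - β) ≤
      R.usage β (R.initial μ) (fun _ x => PMF.pure (R.greedy β (lam - ε) x)) := by
    rcases le_total 0 (lam - ε) with hl | hl
    · have h := hlam.usage_greedy hβ0 hβ1 hl
      rw [sub_sub_cancel_left, neg_mul, neg_mul, neg_le_neg_iff] at h
      exact le_of_mul_le_mul_left h hε
    · rw [R.usage_greedy_of_nonpos hβ0 hβ1 hl]
      exact div_le_div_of_nonneg_right (by exact_mod_cast hm) h1β.le
  obtain ⟨π, hπ, hsupp⟩ := exists_policy_discounted_eq hβ0 hβ1 R.isBdd_active _ _ hlow hhigh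
  refine ⟨π, hπ, discounted_le hβ0 hβ1 (R.isBdd_sumGap hβ0 hβ1 lam) fun h x u hu => ?_⟩
  rcases hsupp h x u hu with rfl | rfl
  · refine (R.sumGap_greedy_le hβ0 hβ1 lam _ x).trans_eq ?_
    rw [sub_add_cancel_left, abs_neg, abs_of_pos hε]
  · refine (R.sumGap_greedy_le hβ0 hβ1 lam _ x).trans_eq ?_
    rw [sub_sub_cancel, abs_of_pos hε]

variable {R} in
/-- Complementary slackness: an optimal decoupled policy only takes actions that are optimal for the
single bandits. -/
theorem IsOptimalRelaxed.gap_eq_zero {π : Fin Q → Belief N → PMF Bool}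
    (hπ : R.IsOptimalRelaxed β μ π) {lam : ℝ} (hlam : R.IsOptimalCharge β μ lam)
    (hβ0 : 0 ≤ β) (hβ1 : β < 1) (hm : R.m ≤ R.M) {x : R.State} (hx : x ∈ (R.initial μ).support)
    {v : R.Action} (hv : v ∈ (R.decoupled π [] x).support) (i : Fin R.M) :
    (R.src i).gap β lam (x i) (v i) = 0 := by
  have h1β : 0 < 1 - β := sub_pos.2 hβ1
  set K := (R.M : ℝ) * (1 + 2 / (1 - β)) / (1 - β) with hK
  have hK0 : 0 ≤ K := by positivity
  have hle : ∀ ε > 0, discounted β R.step (R.sumGap β lam) (R.decoupled π) (R.initial μ) ≤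
      K * ε := by
    intro ε hε
    obtain ⟨κ, hκ, hgap⟩ := hlam.exists_relaxedAdmissible hβ0 hβ1 hm hε
    have h1 := R.cost_add_mul_usage hβ0 hβ1 lam (R.initial μ) κ
    have h2 := R.cost_add_mul_usage hβ0 hβ1 lam (R.initial μ) (R.decoupled π)
    have h3 := hπ.2 κ hκ
    have h4 := hπ.1
    rw [RelaxedAdmissible] at h4 hκ
    rw [h4] at h2
    rw [hκ] at h1
    have h5 : R.M * ((1 + 2 / (1 - β)) * ε) / (1 - β) = K * ε := by rw [hK]; ring
    linarith
  have h0 : discounted β R.step (R.sumGap β lam) (R.decoupled π) (R.initial μ) = 0 := by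
    refine le_antisymm (le_of_forall_pos_le_add fun δ hδ => ?_)
      (discounted_nonneg hβ0 (R.sumGap_nonneg hβ0 hβ1 lam))
    refine (hle (δ / (K + 1)) (by positivity)).trans ?_
    rw [zero_add, mul_div_assoc', div_le_iff₀ (by positivity)]
    nlinarith
  have h1 : R.sumGap β lam x v = 0 :=
    eq_zero_of_discounted_eq_zero hβ0 hβ1 (R.isBdd_sumGap hβ0 hβ1 lam)
      (R.sumGap_nonneg hβ0 hβ1 lam) h0 hx hv
  exact (Finset.sum_eq_zero_iff_of_nonneg fun i _ =>
    Source.gap_nonneg _ hβ0 hβ1 lam _ _).1 h1 i (Finset.mem_univ i)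

end RMAB

/-! ### Coupling the gain index policy with the decoupled policy -/

theorem stateLaw_map {S S' : Type*} {k : S → PMF S} {k' : S' → PMF S'} {f : S → S'}
    (h : ∀ z, (k z).map f = k' (f z)) (p : PMF S) (n : ℕ) :
    (stateLaw k p n).map f = stateLaw k' (p.map f) n := by
  induction n with
  | zero => rfl
  | succ n ih =>
    rw [stateLaw, stateLaw, ← ih, PMF.map_bind, PMF.bind_map]
    congr 1
    funext z
    exact h z

theorem discounted_stationary {S A : Type*} {β : ℝ} {step : S → A → PMF S} {f : S → ℝ}
    (hf : IsBdd f) (κ : S → PMF A) (p₀ : PMF S) :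
    discounted β step (fun x _ => f x) (fun _ x => κ x) p₀ =
      ∑' n, β ^ n * expect (stateLaw (fun x => (κ x).bind (step x)) p₀ n) f := by
  refine tsum_congr fun n => ?_
  rw [stateActionLaw_stationary, expect_bind (hf.comp _)]
  simp only [expect_map _ (hf.comp Prod.fst), expect_const]

/-- If no two elements outside `b` lie in `s \ t` and `t \ s`, then `s` and `t` differ outside `b` in
few elements. -/
theorem card_filter_mem_ne_mem_le {ι : Type*} [Fintype ι] [DecidableEq ι] (s t b : Finset ι)
    (h : ∀ i ∈ s \ t, ∀ j ∈ t \ s, i ∉ b → j ∈ b) :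
    ((Finset.univ.filter fun i => i ∉ b ∧ ¬(i ∈ s ↔ i ∈ t)).card : ℝ) ≤
      b.card + |(t.card : ℝ) - s.card| := by
  have hs : ((s \ t).card : ℝ) + (s ∩ t).card = s.card := by
    exact_mod_cast Finset.card_sdiff_add_card_inter s t
  have ht : ((t \ s).card : ℝ) + (s ∩ t).card = t.card := by
    rw [Finset.inter_comm]
    exact_mod_cast Finset.card_sdiff_add_card_inter t s
  have hl := neg_abs_le ((t.card : ℝ) - s.card)
  have hr := le_abs_self ((t.card : ℝ) - s.card)
  by_cases hst : s \ t ⊆ b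
  · have h1 : ((s \ t).card : ℝ) ≤ b.card := by exact_mod_cast Finset.card_le_card hst
    have h2 : ((Finset.univ.filter fun i => i ∉ b ∧ ¬(i ∈ s ↔ i ∈ t)).card : ℝ) ≤ (t \ s).card := by
      refine mod_cast Finset.card_le_card fun i hi => ?_
      have h3 := @hst i
      simp only [Finset.mem_filter, Finset.mem_univ, true_and, Finset.mem_sdiff] at hi h3 ⊢
      tauto
    linarith
  · obtain ⟨i, hi, hib⟩ := Finset.not_subset.1 hst
    have hts : t \ s ⊆ b := fun j hj => h i hi j hj hib
    have h1 : ((t \ s).card : ℝ) ≤ b.card := by exact_mod_cast Finset.card_le_card hts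
    have h2 : ((Finset.univ.filter fun i => i ∉ b ∧ ¬(i ∈ s ↔ i ∈ t)).card : ℝ) ≤ (s \ t).card := by
      refine mod_cast Finset.card_le_card fun i hi => ?_
      have h3 := @hts i
      simp only [Finset.mem_filter, Finset.mem_univ, true_and, Finset.mem_sdiff] at hi h3 ⊢
      tauto
    linarith

namespace RMAB

variable (R : RMAB source) {β : ℝ} {μ : Fin Q → PMF (Belief N)} {π : Fin Q → Belief N → PMF Bool}
  {sel : R.State → R.Action → Finset (Fin R.M)}

theorem initial_bind_decoupled (μ : Fin Q → PMF (Belief N)) (π : Fin Q → Belief N → PMF Bool) :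
    ((R.initial μ).bind fun x => R.decoupled π [] x) =
      indep fun i => (μ (R.cls i)).bind (π (R.cls i)) :=
  indep_bind _ _

theorem initial_invariant (hμ : ∀ k, (source k).IsEquilibrium (π k) (μ k)) :
    ((R.initial μ).bind fun x => (R.decoupled π [] x).bind (R.step x)) = R.initial μ := by
  have h : ∀ x : R.State, (R.decoupled π [] x).bind (R.step x) =
      indep fun i => (π (R.cls i) (x i)).bind ((R.src i).step (x i)) := fun x => indep_bind _ _
  simp only [h]
  refine (indep_bind _ fun i y => (π (R.cls i) y).bind ((R.src i).step y)).trans ?_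
  unfold initial
  congr 1
  funext i
  exact hμ (R.cls i)

theorem usage_decoupled (hβ0 : 0 ≤ β) (hβ1 : β < 1)
    (hμ : ∀ k, (source k).IsEquilibrium (π k) (μ k)) :
    R.usage β (R.initial μ) (R.decoupled π) =
      (∑ i, expect ((μ (R.cls i)).bind (π (R.cls i))) fun u => if u then 1 else 0) / (1 - β) := by
  have hb : IsBdd fun u : Bool => if u then (1 : ℝ) else 0 := .of_fintype _
  rw [← expect_indep_sum _ fun _ => hb, div_eq_mul_inv, ← tsum_geometric_of_lt_one hβ0 hβ1, mul_comm,
    ← tsum_mul_right]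
  refine tsum_congr fun n => ?_
  have h : stateActionLaw R.step (R.decoupled π) (R.initial μ) n =
      (R.initial μ).bind fun x => (R.decoupled π [] x).map fun u => (x, u) := by
    have h0 := stateActionLaw_stationary (step := R.step) (p₀ := R.initial μ)
      (fun x => R.decoupled π [] x) n
    rwa [stateLaw_eq_of_invariant (R.initial_invariant hμ)] at h0
  rw [h, expect_bind R.isBdd_active, ← initial_bind_decoupled, expect_bind (.of_fintype _)]
  congr 2
  funext x
  rw [expect_map _ R.isBdd_active]
  simp only [active_eq_sum]

theorem cost_decoupled (hβ0 : 0 ≤ β) (hβ1 : β < 1)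
    (hμ : ∀ k, (source k).IsEquilibrium (π k) (μ k)) :
    R.cost β (R.initial μ) (R.decoupled π) =
      (∑ i, expect (μ (R.cls i)) entropy) / (1 - β) := by
  rw [← expect_indep_sum _ fun _ => isBdd_entropy, div_eq_mul_inv,
    ← tsum_geometric_of_lt_one hβ0 hβ1, mul_comm, ← tsum_mul_right]
  refine (discounted_stationary R.isBdd_sum_entropy (fun x => R.decoupled π [] x) _).trans ?_
  refine tsum_congr fun n => ?_
  rw [stateLaw_eq_of_invariant (R.initial_invariant hμ)]
  rfl

/-- One transition of a pair of systems, the first one following the selection policy and the second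
one the decoupled policy. Bandits in equal states draw equal actions, and bandits in equal states that
receive equal actions make equal transitions. -/
def coupledStep (π : Fin Q → Belief N → PMF Bool) (sel : R.State → R.Action → Finset (Fin R.M))
    (z : R.State × R.State) : PMF (R.State × R.State) :=
  (indep fun i => couple (π (R.cls i) (z.1 i)) (π (R.cls i) (z.2 i))).bind fun w =>
    (indep fun i => couple
      ((R.src i).step (z.1 i) (decide (i ∈ sel z.1 fun i => (w i).1)))
      ((R.src i).step (z.2 i) (w i).2)).map fun y => (fun i => (y i).1, fun i => (y i).2)

theorem map_snd_indep_couple (z : R.State × R.State) :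
    ((indep fun i => couple (π (R.cls i) (z.1 i)) (π (R.cls i) (z.2 i))).map fun w i => (w i).2) =
      R.decoupled π [] z.2 := by
  rw [indep_map _ fun _ => Prod.snd]
  simp only [couple_map_snd]
  rfl

theorem coupledStep_map_fst (z : R.State × R.State) :
    (R.coupledStep π sel z).map Prod.fst =
      (R.selectionPolicy π sel [] z.1).bind (R.step z.1) := by
  have h : R.decoupled π [] z.1 = (indep fun i => couple (π (R.cls i) (z.1 i))
      (π (R.cls i) (z.2 i))).map fun w i => (w i).1 := by
    rw [indep_map _ fun _ => Prod.fst]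
    simp only [couple_map_fst]
    rfl
  rw [coupledStep, selectionPolicy, PMF.bind_map, h, PMF.bind_map, PMF.map_bind]
  congr 1
  funext w
  rw [PMF.map_comp]
  refine (indep_map _ fun _ => Prod.fst).trans ?_
  simp only [couple_map_fst]
  rfl

theorem coupledStep_map_snd (z : R.State × R.State) :
    (R.coupledStep π sel z).map Prod.snd = (R.decoupled π [] z.2).bind (R.step z.2) := by
  rw [coupledStep, ← map_snd_indep_couple, PMF.bind_map, PMF.map_bind]
  congr 1
  funext w
  rw [PMF.map_comp]
  refine (indep_map _ fun _ => Prod.snd).trans ?_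
  simp only [couple_map_snd]
  rfl

/-- The joint law of the two systems after `n` transitions. -/
def coupledLaw (μ : Fin Q → PMF (Belief N)) (π : Fin Q → Belief N → PMF Bool)
    (sel : R.State → R.Action → Finset (Fin R.M)) (n : ℕ) : PMF (R.State × R.State) :=
  stateLaw (R.coupledStep π sel) ((R.initial μ).map fun x => (x, x)) n

theorem coupledLaw_map_fst (n : ℕ) :
    (R.coupledLaw μ π sel n).map Prod.fst =
      stateLaw (fun x => (R.selectionPolicy π sel [] x).bind (R.step x)) (R.initial μ) n := by
  rw [coupledLaw, stateLaw_map
    (k' := fun x => (R.selectionPolicy π sel [] x).bind (R.step x)) R.coupledStep_map_fst, PMF.map_comp]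
  congr 1
  exact PMF.map_id _

theorem coupledLaw_map_snd (hμ : ∀ k, (source k).IsEquilibrium (π k) (μ k)) (n : ℕ) :
    (R.coupledLaw μ π sel n).map Prod.snd = R.initial μ := by
  have h : ((R.initial μ).map fun x => (x, x)).map Prod.snd = R.initial μ := by
    rw [PMF.map_comp]
    exact PMF.map_id _
  rw [coupledLaw, stateLaw_map (k' := fun x => (R.decoupled π [] x).bind (R.step x))
    R.coupledStep_map_snd, h, stateLaw_eq_of_invariant (R.initial_invariant hμ)]

open Classical in
/-- The bandits whose states differ. -/
def disagree (z : R.State × R.State) : Finset (Fin R.M) :=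
  Finset.univ.filter fun i => z.1 i ≠ z.2 i

theorem mem_disagree {z : R.State × R.State} {i : Fin R.M} : i ∈ R.disagree z ↔ z.1 i ≠ z.2 i := by
  simp [disagree]

theorem card_disagree_le (z : R.State × R.State) : ((R.disagree z).card : ℝ) ≤ R.M := by
  exact_mod_cast (Finset.card_le_univ _).trans_eq (Fintype.card_fin _)

theorem isBdd_card_disagree : IsBdd fun z : R.State × R.State => ((R.disagree z).card : ℝ) :=
  ⟨R.M, fun z => by
    rw [abs_of_nonneg (Nat.cast_nonneg _)]
    exact R.card_disagree_le z⟩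

variable {R} in
theorem IsGainSelection.card_disagree_le {lam : ℝ} (hsel : R.IsGainSelection β lam sel)
    (hβ : 0 < β) {z : R.State × R.State} {w : Fin R.M → Bool × Bool}
    (htrue : ∀ i, (w i).2 = true → lam ≤ β * R.index β lam z.2 i)
    (hfalse : ∀ i, (w i).2 = false → β * R.index β lam z.2 i ≤ lam)
    (hw : ∀ i, z.1 i = z.2 i → (w i).1 = (w i).2) {y : R.State × R.State}
    (hy : ∀ i, z.1 i = z.2 i → decide (i ∈ sel z.1 fun i => (w i).1) = (w i).2 → y.1 i = y.2 i) :
    ((R.disagree y).card : ℝ) ≤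
      2 * (R.disagree z).card + |(R.active fun i => (w i).2 : ℝ) - R.m| := by
  classical
  set s := sel z.1 fun i => (w i).1 with hs
  set t : Finset (Fin R.M) := Finset.univ.filter fun i => (w i).2 = true with ht
  obtain ⟨hcard, hrank⟩ := hsel z.1 fun i => (w i).1
  have hindex : ∀ i, i ∉ R.disagree z → R.index β lam z.1 i = R.index β lam z.2 i := by
    intro i hi
    rw [mem_disagree, not_not] at hi
    rw [index, index, hi]
  have hst : ∀ i ∈ s \ t, ∀ j ∈ t \ s, i ∉ R.disagree z → j ∈ R.disagree z := by
    intro i hi j hj hib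
    by_contra hjb
    simp only [ht, Finset.mem_sdiff, Finset.mem_filter, Finset.mem_univ, true_and,
      Bool.not_eq_true] at hi hj
    have h1 := hfalse i hi.2
    have h2 := htrue j hj.1
    rw [← hindex i hib] at h1
    rw [← hindex j hjb] at h2
    have h3 : R.index β lam z.1 i ≤ R.index β lam z.1 j :=
      le_of_mul_le_mul_left (h1.trans h2) hβ
    rcases hrank i hi.1 j hj.2 with h | ⟨-, h⟩
    · exact absurd h3 (not_le.2 h)
    · rw [mem_disagree, not_not] at hib hjb
      rw [hw i hib, hw j hjb, hj.1, hi.2] at h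
      exact absurd (h rfl) (by simp)
  have h1 := card_filter_mem_ne_mem_le s t (R.disagree z) hst
  have h2 : R.disagree y ⊆ R.disagree z ∪
      Finset.univ.filter fun i => i ∉ R.disagree z ∧ ¬(i ∈ s ↔ i ∈ t) := by
    intro i hi
    rw [mem_disagree] at hi
    rw [Finset.mem_union, Finset.mem_filter]
    by_cases hz : i ∈ R.disagree z
    · exact Or.inl hz
    refine Or.inr ⟨Finset.mem_univ i, hz, fun hiff => hi (hy i ?_ ?_)⟩
    · rwa [mem_disagree, not_not] at hz
    · rw [Bool.eq_iff_iff, decide_eq_true_iff]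
      simpa [ht] using hiff
  have h3 : ((R.disagree y).card : ℝ) ≤ (R.disagree z).card +
      (Finset.univ.filter fun i => i ∉ R.disagree z ∧ ¬(i ∈ s ↔ i ∈ t)).card := by
    exact_mod_cast (Finset.card_le_card h2).trans (Finset.card_union_le _ _)
  have h4 : (R.active fun i => (w i).2) = t.card := rfl
  rw [hcard] at h1
  rw [h4]
  linarith

variable {R} in
theorem IsOptimalRelaxed.expect_coupledStep_le (hπ : R.IsOptimalRelaxed β μ π) {lam : ℝ}
    (hlam : R.IsOptimalCharge β μ lam) (hsel : R.IsGainSelection β lam sel)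
    (hβ0 : 0 < β) (hβ1 : β < 1) (hm : R.m ≤ R.M) {z : R.State × R.State}
    (hz : z.2 ∈ (R.initial μ).support) :
    expect (R.coupledStep π sel z) (fun y => ((R.disagree y).card : ℝ)) ≤
      2 * (R.disagree z).card +
        expect (R.decoupled π [] z.2) fun v => |(R.active v : ℝ) - R.m| := by
  have hb := R.isBdd_card_disagree
  rw [coupledStep, expect_bind hb, ← map_snd_indep_couple, expect_map _ (.of_fintype _),
    ← expect_const (indep fun i => couple (π (R.cls i) (z.1 i)) (π (R.cls i) (z.2 i)))
      (2 * ((R.disagree z).card : ℝ)), ← expect_add (.of_fintype _) (.of_fintype _)]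
  refine expect_mono (.of_fintype _) (.of_fintype _) fun w hw => ?_
  rw [expect_map _ hb]
  refine expect_le_const (hb.comp _) fun y hy => ?_
  have hv : (fun i => (w i).2) ∈ (R.decoupled π [] z.2).support := by
    rw [← map_snd_indep_couple (z := z), PMF.mem_support_map_iff]
    exact ⟨w, hw, rfl⟩
  have hgap := hπ.gap_eq_zero hlam hβ0.le hβ1 hm hz hv
  refine hsel.card_disagree_le hβ0 (fun i hi => ?_) (fun i hi => ?_) (fun i hi => ?_) fun i hi hu => ?_
  · have h := hgap i
    simp only [hi] at h
    exact Source.le_of_gap_true_eq_zero _ hβ0.le hβ1 h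
  · have h := hgap i
    simp only [hi] at h
    exact Source.le_of_gap_false_eq_zero _ hβ0.le hβ1 h
  · exact fst_eq_snd_of_mem_support_couple (by rw [hi]) (mem_support_indep hw i)
  · exact fst_eq_snd_of_mem_support_couple (by rw [hi, hu]) (mem_support_indep hy i)

variable {R} in
theorem IsOptimalRelaxed.expect_abs_active_sub_le (hπ : R.IsOptimalRelaxed β μ π)
    (hμ : ∀ k, (source k).IsEquilibrium (π k) (μ k)) (hβ0 : 0 ≤ β) (hβ1 : β < 1) :
    expect (R.initial μ) (fun x => expect (R.decoupled π [] x) fun v => |(R.active v : ℝ) - R.m|) ≤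
      √R.M := by
  set a : Fin R.M → ℝ := fun i =>
    expect ((μ (R.cls i)).bind (π (R.cls i))) fun u => if u then 1 else 0 with ha
  have hsum : ∑ i, a i = R.m := by
    have h := hπ.1
    rw [RelaxedAdmissible, R.usage_decoupled hβ0 hβ1 hμ] at h
    exact (div_left_inj' (sub_pos.2 hβ1).ne').1 h
  have ha01 : ∀ i, 0 ≤ a i ∧ a i ≤ 1 := fun i =>
    ⟨expect_nonneg fun u _ => by split_ifs <;> norm_num,
      expect_le_const (.of_fintype _) fun u _ => by split_ifs <;> norm_num⟩
  rw [← expect_bind (.of_fintype _), initial_bind_decoupled]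
  have h := expect_indep_abs_sum_le (fun i => (μ (R.cls i)).bind (π (R.cls i)))
    (fun i u => (if u then 1 else 0) - a i) (fun i => ?_) fun i u => ?_
  · rw [Fintype.card_fin] at h
    refine (expect_congr fun v _ => ?_).trans_le h
    rw [Finset.sum_sub_distrib, hsum, active_eq_sum]
  · rw [expect_sub (.of_fintype _) (.const _), expect_const]
    exact sub_self _
  · have := ha01 i
    rw [abs_le]
    split_ifs <;> constructor <;> linarith

variable {R} in
/-- The gain index policy and the decoupled policy differ in few bandits. -/
theorem IsOptimalRelaxed.expect_card_disagree_le (hπ : R.IsOptimalRelaxed β μ π) {lam : ℝ}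
    (hlam : R.IsOptimalCharge β μ lam) (hsel : R.IsGainSelection β lam sel)
    (hμ : ∀ k, (source k).IsEquilibrium (π k) (μ k)) (hβ0 : 0 ≤ β) (hβ1 : β < 1)
    (hm : R.m ≤ R.M) (n : ℕ) :
    β ^ n * expect (R.coupledLaw μ π sel n) (fun z => ((R.disagree z).card : ℝ)) ≤
      β ^ n * (2 ^ n * √R.M) := by
  have hb := R.isBdd_card_disagree
  have hzero : expect (R.coupledLaw μ π sel 0) (fun z => ((R.disagree z).card : ℝ)) = 0 := by
    rw [coupledLaw, stateLaw, expect_map _ hb]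
    simp [disagree, expect_const]
  rcases hβ0.eq_or_lt with rfl | hβ
  · cases n with
    | zero =>
      rw [hzero]
      simp
    | succ n => simp
  refine mul_le_mul_of_nonneg_left ?_ (pow_nonneg hβ0 n)
  suffices h : expect (R.coupledLaw μ π sel n) (fun z => ((R.disagree z).card : ℝ)) ≤
      (2 ^ n - 1) * √R.M from
    h.trans (mul_le_mul_of_nonneg_right (by linarith) (Real.sqrt_nonneg _))
  induction n with
  | zero =>
    rw [hzero]
    simp
  | succ n ih =>
    have hg : IsBdd fun x : R.State =>
        expect (R.decoupled π [] x) fun v => |(R.active v : ℝ) - R.m| :=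
      isBdd_expect (.of_fintype _) _
    have h1 : expect (R.coupledLaw μ π sel (n + 1)) (fun z => ((R.disagree z).card : ℝ)) ≤
        expect (R.coupledLaw μ π sel n) (fun z => 2 * ((R.disagree z).card : ℝ) +
          expect (R.decoupled π [] z.2) fun v => |(R.active v : ℝ) - R.m|) := by
      rw [coupledLaw, stateLaw, expect_bind hb]
      refine expect_mono (isBdd_expect hb _) ((hb.const_mul 2).add (hg.comp Prod.snd)) fun z hz => ?_
      refine hπ.expect_coupledStep_le hlam hsel hβ hβ1 hm ?_
      rw [← R.coupledLaw_map_snd hμ (sel := sel) n, PMF.mem_support_map_iff]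
      exact ⟨z, hz, rfl⟩
    rw [expect_add (hb.const_mul 2) (hg.comp Prod.snd), expect_const_mul, ← expect_map Prod.snd hg,
      R.coupledLaw_map_snd hμ] at h1
    have h2 := hπ.expect_abs_active_sub_le hμ hβ0 hβ1
    rw [pow_succ]
    linarith

theorem abs_sum_entropy_sub_le {C : ℝ} (hC : ∀ x : Belief N, |entropy x| ≤ C)
    (z : R.State × R.State) :
    |∑ i, entropy (z.1 i) - ∑ i, entropy (z.2 i)| ≤ 2 * C * (R.disagree z).card := by
  classical
  rw [← Finset.sum_sub_distrib, mul_comm, ← nsmul_eq_mul, ← Finset.sum_const]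
  have h : ∀ i ∉ R.disagree z, entropy (z.1 i) - entropy (z.2 i) = 0 := by
    intro i hi
    rw [mem_disagree, not_not] at hi
    rw [hi, sub_self]
  rw [← Finset.sum_subset (Finset.subset_univ (R.disagree z)) fun i _ hi => h i hi]
  refine (Finset.abs_sum_le_sum_abs _ _).trans (Finset.sum_le_sum fun i _ => ?_)
  refine (abs_sub _ _).trans ?_
  linarith [hC (z.1 i), hC (z.2 i)]

/-- Difference in the `n`-th slot between the expected costs of the selection policy and of the
decoupled policy. -/
def slotExcess (μ : Fin Q → PMF (Belief N)) (π : Fin Q → Belief N → PMF Bool)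
    (sel : R.State → R.Action → Finset (Fin R.M)) (n : ℕ) : ℝ :=
  expect (R.coupledLaw μ π sel n) fun z => ∑ i, entropy (z.1 i) - ∑ i, entropy (z.2 i)

theorem abs_slotExcess_le {C : ℝ} (hC : ∀ x : Belief N, |entropy x| ≤ C) (n : ℕ) :
    |R.slotExcess μ π sel n| ≤
      2 * C * expect (R.coupledLaw μ π sel n) fun z => ((R.disagree z).card : ℝ) := by
  have hb : IsBdd fun z : R.State × R.State => ∑ i, entropy (z.1 i) - ∑ i, entropy (z.2 i) :=
    (R.isBdd_sum_entropy.comp Prod.fst).sub (R.isBdd_sum_entropy.comp Prod.snd)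
  rw [← expect_const_mul]
  exact (abs_expect_le hb).trans (expect_mono hb.abs (R.isBdd_card_disagree.const_mul _)
    fun z _ => R.abs_sum_entropy_sub_le hC z)

theorem abs_slotExcess_le_card {C : ℝ} (hC : ∀ x : Belief N, |entropy x| ≤ C) (hC0 : 0 ≤ C)
    (n : ℕ) : |R.slotExcess μ π sel n| ≤ 2 * C * R.M :=
  (R.abs_slotExcess_le hC n).trans <| mul_le_mul_of_nonneg_left
    (expect_le_const R.isBdd_card_disagree fun z _ => R.card_disagree_le z) (by positivity)

theorem cost_selectionPolicy (hβ0 : 0 ≤ β) (hβ1 : β < 1)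
    (hμ : ∀ k, (source k).IsEquilibrium (π k) (μ k)) :
    R.cost β (R.initial μ) (R.selectionPolicy π sel) =
      R.cost β (R.initial μ) (R.decoupled π) + ∑' n, β ^ n * R.slotExcess μ π sel n := by
  have hb := R.isBdd_sum_entropy
  obtain ⟨C, hC⟩ := id hb
  have h1 : R.cost β (R.initial μ) (R.selectionPolicy π sel) = ∑' n, β ^ n *
      expect (R.coupledLaw μ π sel n) fun z => ∑ i, entropy (z.1 i) := by
    refine (discounted_stationary hb (fun x => R.selectionPolicy π sel [] x) _).trans ?_
    refine tsum_congr fun n => ?_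
    rw [← coupledLaw_map_fst, expect_map _ hb]
  have h2 : R.cost β (R.initial μ) (R.decoupled π) = ∑' n, β ^ n *
      expect (R.coupledLaw μ π sel n) fun z => ∑ i, entropy (z.2 i) := by
    refine (discounted_stationary hb (fun x => R.decoupled π [] x) _).trans ?_
    refine tsum_congr fun n => ?_
    rw [stateLaw_eq_of_invariant (R.initial_invariant hμ), ← R.coupledLaw_map_snd hμ (sel := sel) n,
      expect_map _ hb]
  have hs : ∀ f : R.State × R.State → R.State, Summable fun n => β ^ n *
      expect (R.coupledLaw μ π sel n) fun z => ∑ i, entropy (f z i) := fun f =>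
    summable_discount hβ0 hβ1 fun n => abs_expect_le_const fun z => hC (f z)
  rw [h1, h2, ← sub_eq_iff_eq_add', ← (hs Prod.fst).tsum_sub (hs Prod.snd)]
  refine tsum_congr fun n => ?_
  rw [slotExcess, expect_sub (hb.comp Prod.fst) (hb.comp Prod.snd), mul_sub]

theorem cost_nonneg (hβ0 : 0 ≤ β) (p₀ : PMF R.State) (π : Policy R.State R.Action) :
    0 ≤ R.cost β p₀ π :=
  discounted_nonneg hβ0 fun _ _ => Finset.sum_nonneg fun _ _ => entropy_nonneg _

variable {R} in
theorem IsOptimalRelaxed.relValue_eq (hπ : R.IsOptimalRelaxed β μ π) (hβ0 : 0 ≤ β) :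
    R.relValue β (R.initial μ) = R.cost β (R.initial μ) (R.decoupled π) := by
  have : Nonempty {κ : Policy R.State R.Action // R.RelaxedAdmissible β (R.initial μ) κ} :=
    ⟨_, hπ.1⟩
  refine le_antisymm (ciInf_le ⟨0, ?_⟩ (⟨R.decoupled π, hπ.1⟩ :
    {κ : Policy R.State R.Action // R.RelaxedAdmissible β (R.initial μ) κ})) (le_ciInf fun κ => ?_)
  · rintro _ ⟨κ, rfl⟩
    exact R.cost_nonneg hβ0 _ _
  · exact hπ.2 κ.1 κ.2

variable {R} in
theorem Admissible.relaxedAdmissible {κ : Policy R.State R.Action} (hκ : R.Admissible κ)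
    (hβ0 : 0 ≤ β) (hβ1 : β < 1) (p₀ : PMF R.State) : R.RelaxedAdmissible β p₀ κ :=
  discounted_eq_of_forall hβ0 hβ1 fun h x u hu => by rw [hκ h x u hu]

variable {R} in
theorem IsGainSelection.admissible {lam : ℝ} (hsel : R.IsGainSelection β lam sel) :
    R.Admissible (R.selectionPolicy π sel) := by
  intro h x u hu
  rw [selectionPolicy, PMF.mem_support_map_iff] at hu
  obtain ⟨v, -, rfl⟩ := hu
  simp [active, (hsel x v).1]

variable {R} in
theorem IsGainSelection.optValue_le {lam : ℝ} (hsel : R.IsGainSelection β lam sel) (hβ0 : 0 ≤ β)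
    (p₀ : PMF R.State) : R.optValue β p₀ ≤ R.cost β p₀ (R.selectionPolicy π sel) := by
  refine ciInf_le ⟨0, ?_⟩ (⟨R.selectionPolicy π sel, hsel.admissible⟩ :
    {κ : Policy R.State R.Action // R.Admissible κ})
  rintro _ ⟨κ, rfl⟩
  exact R.cost_nonneg hβ0 _ _

variable {R} in
theorem IsOptimalRelaxed.cost_decoupled_le_optValue (hπ : R.IsOptimalRelaxed β μ π) {lam : ℝ}
    (hsel : R.IsGainSelection β lam sel) (hβ0 : 0 ≤ β) (hβ1 : β < 1) :
    R.cost β (R.initial μ) (R.decoupled π) ≤ R.optValue β (R.initial μ) := by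
  have : Nonempty {κ : Policy R.State R.Action // R.Admissible κ} :=
    ⟨R.selectionPolicy π sel, hsel.admissible⟩
  exact le_ciInf fun κ => hπ.2 κ.1 (κ.2.relaxedAdmissible hβ0 hβ1 _)

theorem sum_cls {q : Fin Q → ℝ}
    (hcls : ∀ k, ((Finset.univ.filter fun i => R.cls i = k).card : ℝ) = q k * R.M)
    (f : Fin Q → ℝ) : ∑ i, f (R.cls i) = R.M * ∑ k, q k * f k := by
  rw [← Finset.sum_fiberwise _ R.cls, Finset.mul_sum]
  refine Finset.sum_congr rfl fun k _ => ?_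
  rw [Finset.sum_congr rfl fun i hi => by rw [(Finset.mem_filter.1 hi).2], Finset.sum_const,
    nsmul_eq_mul, hcls]
  ring

end RMAB

end UoI

end

open UoI in
theorem theorem5 {Q N : ℕ} (hN : 2 ≤ N) (source : Fin Q → Source N)
    (β : ℝ) (hβ0 : 0 ≤ β) (hβ1 : β < 1)
    (q : Fin Q → ℝ) (hq : ∀ k, 0 < q k) (hq1 : ∑ k, q k = 1)
    (α : ℝ) (hα0 : 0 < α) (hα1 : α < 1)
    -- the relaxed policy of each class, with an equilibrium law
    (π : Fin Q → Belief N → PMF Bool) (μ : Fin Q → PMF (Belief N))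
    (hμ : ∀ k, (source k).IsEquilibrium (π k) (μ k))
    -- a sequence of systems with fixed proportions and growing number of bandits
    (R : ℕ → RMAB source)
    (hcls : ∀ j k, ((Finset.univ.filter fun i => (R j).cls i = k).card : ℝ) = q k * (R j).M)
    (hm : ∀ j, ((R j).m : ℝ) = α * (R j).M)
    (hM : Tendsto (fun j => (R j).M) atTop atTop)
    -- the optimal charges, and optimality of the relaxed policy
    (lam : ℕ → ℝ) (hlam : ∀ j, (R j).IsOptimalCharge β μ (lam j))
    (hπ : ∀ j, (R j).IsOptimalRelaxed β μ π)
    -- the gain index policies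
    (sel : ∀ j, (R j).State → (R j).Action → Finset (Fin (R j).M))
    (hsel : ∀ j, (R j).IsGainSelection β (lam j) (sel j)) :
    ∃ L : ℝ,
      Tendsto (fun j => (R j).cost β ((R j).initial μ) ((R j).selectionPolicy π (sel j)) / (R j).M)
        atTop (𝓝 L) ∧
      Tendsto (fun j => (R j).optValue β ((R j).initial μ) / (R j).M) atTop (𝓝 L) ∧
      Tendsto (fun j => (R j).relValue β ((R j).initial μ) / (R j).M) atTop (𝓝 L) := by
  have hmM : ∀ j, (R j).m ≤ (R j).M := by
    intro j
    have h : ((R j).m : ℝ) ≤ (R j).M := by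
      rw [hm j]
      exact mul_le_of_le_one_left (Nat.cast_nonneg _) hα1.le
    exact_mod_cast h
  have hMr : Tendsto (fun j => ((R j).M : ℝ)) atTop atTop :=
    tendsto_natCast_atTop_atTop.comp hM
  obtain ⟨C, hC⟩ := isBdd_entropy (N := N)
  have hC0 : 0 ≤ C := (abs_nonneg _).trans (hC ((source ⟨0, ?_⟩).obs ⟨0, by omega⟩))
  swap
  · rcases Nat.eq_zero_or_pos Q with rfl | h
    · simp at hq1
    · exact h
  have hrel : Tendsto (fun j => (R j).cost β ((R j).initial μ) ((R j).decoupled π) / (R j).M)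
      atTop (𝓝 ((∑ k, q k * expect (μ k) entropy) / (1 - β))) := by
    refine tendsto_const_nhds.congr' ?_
    filter_upwards [hMr.eventually_gt_atTop 0] with j hj
    rw [(R j).cost_decoupled hβ0 hβ1 hμ, (R j).sum_cls (hcls j) fun k => expect (μ k) entropy]
    field_simp
  have hexcess : Tendsto (fun j => ∑' n, β ^ n * (R j).slotExcess μ π (sel j) n / (R j).M) atTop
      (𝓝 (∑' _ : ℕ, (0 : ℝ))) := by
    refine tendsto_tsum_of_dominated_convergence (bound := fun n => β ^ n * (2 * C))
      ((summable_geometric_of_lt_one hβ0 hβ1).mul_right _) (fun n => ?_)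
      (Eventually.of_forall fun j n => ?_)
    · have hlim : Tendsto (fun j => 2 * C * (β ^ n * 2 ^ n) * (√(R j).M)⁻¹) atTop (𝓝 0) := by
        rw [← mul_zero (2 * C * (β ^ n * 2 ^ n))]
        exact (tendsto_inv_atTop_zero.comp (Real.tendsto_sqrt_atTop.comp hMr)).const_mul _
      refine squeeze_zero_norm' ?_ hlim
      filter_upwards [hMr.eventually_gt_atTop 0] with j hj
      rw [Real.norm_eq_abs, abs_div, abs_mul, abs_of_nonneg (pow_nonneg hβ0 n), abs_of_pos hj,
        div_le_iff₀ hj]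
      have h1 := mul_le_mul_of_nonneg_left
        ((R j).abs_slotExcess_le (μ := μ) (π := π) (sel := sel j) hC n) (pow_nonneg hβ0 n)
      have h2 := mul_le_mul_of_nonneg_left
        ((hπ j).expect_card_disagree_le (hlam j) (hsel j) hμ hβ0 hβ1 (hmM j) n)
        (show 0 ≤ 2 * C by positivity)
      have h3 : (√((R j).M : ℝ))⁻¹ * (R j).M = √(R j).M := by
        rw [inv_mul_eq_div, Real.div_sqrt]
      rw [mul_assoc _ _ ((R j).M : ℝ), h3]
      linarith
    · rw [Real.norm_eq_abs, abs_div, abs_mul, abs_of_nonneg (pow_nonneg hβ0 n), Nat.abs_cast,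
        mul_div_assoc]
      exact mul_le_mul_of_nonneg_left
        (div_le_of_le_mul₀ (Nat.cast_nonneg _) (by positivity) ((R j).abs_slotExcess_le_card hC hC0 n))
        (pow_nonneg hβ0 n)
  have hind : Tendsto
      (fun j => (R j).cost β ((R j).initial μ) ((R j).selectionPolicy π (sel j)) / (R j).M)
      atTop (𝓝 ((∑ k, q k * expect (μ k) entropy) / (1 - β))) := by
    have h := hrel.add hexcess
    rw [tsum_zero, add_zero] at h
    refine h.congr fun j => ?_
    rw [(R j).cost_selectionPolicy hβ0 hβ1 hμ, add_div, tsum_div_const]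
  refine ⟨_, hind, tendsto_of_tendsto_of_tendsto_of_le_of_le hrel hind (fun j => ?_) fun j => ?_, ?_⟩
  · exact div_le_div_of_nonneg_right ((hπ j).cost_decoupled_le_optValue (hsel j) hβ0 hβ1)
      (Nat.cast_nonneg _)
  · exact div_le_div_of_nonneg_right ((hsel j).optValue_le hβ0 _) (Nat.cast_nonneg _)
  · refine hrel.congr fun j => ?_
    rw [(hπ j).relValue_eq hβ0]
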